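/- Let $G$ be an abelian group, written additively. A zero-sum sequence over $G$ is a finite unordered sequence of elements of $G$ (repetition allowed) whose sum is $0$; these sequences form a commutative monoid $\mathcal B(G)$ under concatenation, a submonoid of the free abelian monoid with basis $G$. An atom of $\mathcal B(G)$ is a minimal zero-sum sequence, that is, a non-empty zero-sum sequence that is not the concatenation of two non-empty zero-sum sequences. For $S \in \mathcal B(G)$ let $$\mathsf L(S) = \{ k \in \mathbb N_0 \mid S = U_1 \cdot \ldots \cdot U_k \text{ for some atoms } U_1, \ldots, U_k \text{ of } \mathcal B(G) \}$$ be its set of lengths (so that $\mathsf L(S)=\{0\}$ for the empty sequence $S$), and let $\mathcal L(G) = \{ \mathsf L(S) \mid S \in \mathcal B(G)\}$ be the system of sets of lengths of $G$. Write $C_m$ for a cyclic group of order $m$. **Corollary 1.3.** Let $G$ be an abelian group (finite or infinite). 1. If $\mathcal L(G) = \mathcal L(C_2^{r-1} \oplus C_4)$ for some integer $r \ge 2$, then $G \cong C_2^{r-1} \oplus C_4$. 2. If $\mathcal L(G) = \mathcal L(C_2 \oplus C_{2n})$ for some integer $n \ge 2$, then $G \cong C_2 \oplus C_{2n}$. 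-/

import Mathlib

namespace SetsOfLengths

section Monoids

variable {H : Type*} [CommMonoid H]

/-- The factorizations of `a ∈ H`: the formal products (multisets) of atoms of the reduced monoid
`H_red = H / Hˣ` (which is `Associates H`) whose product in `H_red` is the class of `a`. -/
def factorizations (a : H) : Set (Multiset (Associates H)) :=
  {z | (∀ u ∈ z, Irreducible u) ∧ z.prod = Associates.mk a}

/-- The set of lengths `L(a)`: the numbers of atoms, counted with multiplicity, in the
factorizations of `a`. -/
def lengths (a : H) : Set ℕ :=
  {k | ∃ z ∈ factorizations a, Multiset.card z = k}

end Monoids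

/-- The system of sets of lengths `{L(a) | a ∈ H}` of a commutative monoid `H`. -/
def lengthSystem (H : Type*) [CommMonoid H] : Set (Set ℕ) :=
  Set.range (lengths : H → Set ℕ)

/-- The monoid `B(G)` of zero-sum sequences over `G`, a submonoid of the free abelian monoid with
basis `G`, which is the monoid of finite multisets of elements of `G`, written multiplicatively. -/
def zeroSumSequences (G : Type*) [AddCommGroup G] : Submonoid (Multiplicative (Multiset G)) where
  carrier := {S | S.toAdd.sum = 0}
  one_mem' := by simp
  mul_mem' := by
    intro S T hS hT
    change S.toAdd.sum = 0 at hS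
    change T.toAdd.sum = 0 at hT
    change (S * T).toAdd.sum = 0
    rw [toAdd_mul, Multiset.sum_add, hS, hT, add_zero]

/-- The system of sets of lengths of an abelian group `G`, that is, of the monoid `B(G)`. -/
def groupLengthSystem (G : Type*) [AddCommGroup G] : Set (Set ℕ) :=
  lengthSystem (zeroSumSequences G)

end SetsOfLengths

/-! Let D be the maximal length of an atom over the given group H. If 2 ∈ L(S), then S is a product
of two atoms and no length of S exceeds D. Since L(W(-W)) contains 2 and |W|, equality of the two
systems bounds atoms over G by D as well. Over H = C₂ᵇ ⊕ C_m one explicit atom V of length b + m has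
L(V(-V)) = {2, m, b + m}, and b + m = D in the two families (m = 2n, b = 1, and m = 4). This set is
then realized over G, and since it contains both 2 and D, it must be L(U(-U)) for an atom U over G
of length D (`exists_eq_add_negSeq`).

The structure of G is read off U. Disjoint subsequences A, B of U with equal sums give a
factorization of U(-U) of length |U| - (|A| + |B|) + 2p, where A(-B) splits into p atoms
(`exists_length_of_relation`). So few lengths leave few weights |A| + |B|: only 3 and D for {2, D-1,
D}, only D-2 and D for {2, 4, D}. Relations abound, because U has maximal length and hence every
element of G is a subsum of U (`exists_sum_eq`).

In the first case U = g^(D-2)(g+e)e with 2e = 0, whence G ≅ C₂ ⊕ C_(D-1). In the second a single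
term q of order four occurs three times and all doubles in G lie in {0, 2q}; so G ≅ C₂ᶜ ⊕ C₄, and
comparing atom lengths gives c = b. The values of D come from a group-algebra argument for C₂ᵇ ⊕ C₄
and from Erdős–Ginzburg–Ziv for C₂ ⊕ C₂ₙ. -/

namespace SetsOfLengths

/-! ### Translation from the monoid B(G) to multisets -/

section Basic

variable {G : Type*} [AddCommGroup G]

/-- A minimal zero-sum sequence, written as a multiset. -/
def IsMinZeroSum (U : Multiset G) : Prop :=
  U ≠ 0 ∧ U.sum = 0 ∧ ∀ T ≤ U, T.sum = 0 → T = 0 ∨ T = U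

/-- The numbers of minimal zero-sum sequences into which `S` can be partitioned. -/
def partitionLengths (S : Multiset G) : Set ℕ :=
  {k | ∃ z : Multiset (Multiset G), (∀ W ∈ z, IsMinZeroSum W) ∧ z.sum = S ∧ Multiset.card z = k}

lemma isUnit_zeroSumSequences_iff (a : zeroSumSequences G) : IsUnit a ↔ a.1.toAdd = 0 := by
  constructor
  · intro h
    obtain ⟨b, hb⟩ := h.exists_right_inv
    have h1 : (a.1 * b.1).toAdd = 0 := by
      have := congrArg (fun x : zeroSumSequences G => x.1.toAdd) hb
      simpa using this
    rw [toAdd_mul] at h1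
    exact (add_eq_zero.mp h1).1
  · intro h
    have : a = 1 := by
      apply Subtype.ext
      apply Multiplicative.toAdd.injective
      simpa using h
    rw [this]; exact isUnit_one

lemma irreducible_iff_isMinZeroSum (a : zeroSumSequences G) :
    Irreducible a ↔ IsMinZeroSum a.1.toAdd := by
  have hsum : ∀ x : zeroSumSequences G, x.1.toAdd.sum = 0 := fun x => x.2
  rw [irreducible_iff, isUnit_zeroSumSequences_iff]
  refine and_congr Iff.rfl ⟨fun h => ⟨hsum a, fun T hT hT0 => ?_⟩, fun h b c hbc => ?_⟩
  · obtain ⟨R, hR⟩ := Multiset.le_iff_exists_add.mp hT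
    have hR0 : R.sum = 0 := by
      have := hsum a
      rwa [hR, Multiset.sum_add, hT0, zero_add] at this
    have := @h ⟨Multiplicative.ofAdd T, hT0⟩ ⟨Multiplicative.ofAdd R, hR0⟩
      (Subtype.ext (Multiplicative.toAdd.injective (by simpa using hR)))
    rw [isUnit_zeroSumSequences_iff, isUnit_zeroSumSequences_iff] at this
    rcases this with h | h
    · left; simpa using h
    · right
      have h' : R = 0 := by simpa using h
      rw [hR, h', add_zero]
  · rw [isUnit_zeroSumSequences_iff, isUnit_zeroSumSequences_iff]
    have hbc' : a.1.toAdd = b.1.toAdd + c.1.toAdd := by rw [hbc]; rfl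
    rcases h.2 b.1.toAdd (hbc' ▸ Multiset.le_add_right _ _) (hsum b) with h | h
    · left; exact h
    · right; rw [← h] at hbc'; simpa using hbc'

lemma coe_prod_zeroSumSequences (z : Multiset (zeroSumSequences G)) :
    z.prod.1.toAdd = (z.map fun b => b.1.toAdd).sum := by
  induction z using Multiset.induction_on with
  | empty => simp
  | cons a s ih => simp

/-- B(G) is reduced, so passing to associates identifies nothing; this is what
`Associates.mk_injective` needs. -/
instance : Subsingleton (zeroSumSequences G)ˣ := by
  refine ⟨fun u v => Units.ext (Subtype.ext (Multiplicative.toAdd.injective ?_))⟩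
  rw [(isUnit_zeroSumSequences_iff _).mp u.isUnit, (isUnit_zeroSumSequences_iff _).mp v.isUnit]

lemma irreducible_mk_iff (b : zeroSumSequences G) :
    Irreducible (Associates.mk b) ↔ Irreducible b := by
  exact MulEquiv.irreducible_iff (MulEquiv.ofBijective Associates.mkMonoidHom
    ⟨Associates.mk_injective, Associates.mk_surjective⟩) (x := b)

lemma lengths_eq_partitionLengths (a : zeroSumSequences G) :
    lengths a = partitionLengths a.1.toAdd := by
  ext k
  constructor
  · rintro ⟨z, ⟨hz, hp⟩, rfl⟩
    obtain ⟨y, rfl⟩ : ∃ y : Multiset (zeroSumSequences G), y.map Associates.mk = z :=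
      ⟨z.map Quotient.out, by simp [Multiset.map_map, Associates.mk]⟩
    refine ⟨y.map fun b => b.1.toAdd, ?_, ?_, by simp⟩
    · intro W hW
      obtain ⟨b, hb, rfl⟩ := Multiset.mem_map.mp hW
      rw [← irreducible_iff_isMinZeroSum, ← irreducible_mk_iff]
      exact hz _ (Multiset.mem_map_of_mem _ hb)
    · rw [Associates.prod_mk, Associates.mk_eq_mk_iff_associated] at hp
      obtain ⟨u, hu⟩ := hp
      have hu1 : (u : zeroSumSequences G).1.toAdd = 0 :=
        (isUnit_zeroSumSequences_iff _).mp u.isUnit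
      rw [← coe_prod_zeroSumSequences, ← hu]
      simp [hu1]
  · rintro ⟨z, hz, hs, rfl⟩
    obtain ⟨y, rfl⟩ : ∃ y : Multiset (zeroSumSequences G), y.map (fun b => b.1.toAdd) = z := by
      have : ∀ W ∈ z, ∃ b : zeroSumSequences G, b.1.toAdd = W := fun W hW =>
        ⟨⟨Multiplicative.ofAdd W, (hz W hW).2.1⟩, rfl⟩
      choose f hf using this
      refine ⟨z.attach.map fun W => f W.1 W.2, ?_⟩
      rw [Multiset.map_map]
      simp [hf]
    refine ⟨y.map Associates.mk, ⟨?_, ?_⟩, by simp⟩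
    · intro u hu
      obtain ⟨b, hb, rfl⟩ := Multiset.mem_map.mp hu
      rw [irreducible_mk_iff, irreducible_iff_isMinZeroSum]
      exact hz _ (Multiset.mem_map_of_mem (fun b : zeroSumSequences G => b.1.toAdd) hb)
    · rw [Associates.prod_mk]
      congr 1
      apply Subtype.ext
      apply Multiplicative.toAdd.injective
      rw [coe_prod_zeroSumSequences]
      exact hs

lemma mem_groupLengthSystem_iff (L : Set ℕ) :
    L ∈ groupLengthSystem G ↔ ∃ S : Multiset G, S.sum = 0 ∧ partitionLengths S = L := by
  constructor
  · rintro ⟨a, rfl⟩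
    exact ⟨a.1.toAdd, a.2, (lengths_eq_partitionLengths a).symm⟩
  · rintro ⟨S, hS, rfl⟩
    exact ⟨⟨Multiplicative.ofAdd S, hS⟩, lengths_eq_partitionLengths _⟩

lemma IsMinZeroSum.map_equiv {H : Type*} [AddCommGroup H] (e : G ≃+ H) {U : Multiset G}
    (hU : IsMinZeroSum U) : IsMinZeroSum (U.map e) := by
  refine ⟨by simpa using hU.1, by rw [← map_multiset_sum, hU.2.1, map_zero], fun T hT hT0 => ?_⟩
  have h1 : T.map e.symm ≤ U := by
    have := Multiset.map_le_map (f := e.symm) hT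
    simpa [Multiset.map_map, Function.comp_def] using this
  rcases hU.2.2 _ h1 (by rw [← map_multiset_sum, hT0, map_zero]) with h | h
  · left; simpa using h
  · right; rw [← h]; simp [Multiset.map_map]

lemma partitionLengths_subset_map {H : Type*} [AddCommGroup H] (e : G ≃+ H) (S : Multiset G) :
    partitionLengths S ⊆ partitionLengths (S.map e) := by
  rintro k ⟨z, hz, rfl, rfl⟩
  refine ⟨z.map (Multiset.map e), ?_, ?_, by simp⟩
  · intro W hW
    obtain ⟨V, hV, rfl⟩ := Multiset.mem_map.mp hW
    exact (hz V hV).map_equiv e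
  · exact (map_multiset_sum (Multiset.mapAddMonoidHom e) z).symm

lemma groupLengthSystem_congr {H : Type*} [AddCommGroup H] (e : G ≃+ H) :
    groupLengthSystem G = groupLengthSystem H := by
  ext L
  rw [mem_groupLengthSystem_iff, mem_groupLengthSystem_iff]
  constructor
  · rintro ⟨S, hS, rfl⟩
    refine ⟨S.map e, by rw [← map_multiset_sum, hS, map_zero], ?_⟩
    refine Set.Subset.antisymm ?_ (partitionLengths_subset_map e S)
    have := partitionLengths_subset_map e.symm (S.map e)
    simpa [Multiset.map_map, Function.comp_def] using this
  · rintro ⟨S, hS, rfl⟩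
    refine ⟨S.map e.symm, by rw [← map_multiset_sum, hS, map_zero], ?_⟩
    refine Set.Subset.antisymm ?_ (partitionLengths_subset_map e.symm S)
    have := partitionLengths_subset_map e (S.map e.symm)
    simpa [Multiset.map_map, Function.comp_def] using this

end Basic
end SetsOfLengths
namespace SetsOfLengths

/-! ### Factorizations of U(-U) and relations among the terms of U -/

section Sequences

variable {G : Type*} [AddCommGroup G]

/-- The sequence of the negatives of the terms of `U`. -/
def negSeq (U : Multiset G) : Multiset G := U.map Neg.neg

@[simp] lemma card_negSeq (U : Multiset G) : Multiset.card (negSeq U) = Multiset.card U := by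
  simp [negSeq]

@[simp] lemma sum_negSeq (U : Multiset G) : (negSeq U).sum = -U.sum :=
  Multiset.sum_map_neg' U

@[simp] lemma negSeq_add (U V : Multiset G) : negSeq (U + V) = negSeq U + negSeq V := by
  simp [negSeq]

@[simp] lemma negSeq_negSeq (U : Multiset G) : negSeq (negSeq U) = U := by
  simp [negSeq]

@[simp] lemma negSeq_zero : negSeq (0 : Multiset G) = 0 := rfl

@[simp] lemma negSeq_cons (a : G) (U : Multiset G) : negSeq (a ::ₘ U) = -a ::ₘ negSeq U := by
  simp [negSeq]

@[simp] lemma mem_negSeq {a : G} {U : Multiset G} : a ∈ negSeq U ↔ -a ∈ U := by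
  simp only [negSeq, Multiset.mem_map]
  exact ⟨by rintro ⟨b, hb, rfl⟩; simpa using hb, fun h => ⟨-a, h, neg_neg a⟩⟩

lemma count_negSeq [DecidableEq G] (a : G) (U : Multiset G) :
    (negSeq U).count a = U.count (-a) := by
  conv_lhs => rw [← neg_neg a]
  exact Multiset.count_map_eq_count' _ _ neg_injective _

lemma negSeq_le_negSeq {U V : Multiset G} (h : U ≤ V) : negSeq U ≤ negSeq V :=
  Multiset.map_le_map h

lemma negSeq_le_iff {U V : Multiset G} : negSeq U ≤ V ↔ U ≤ negSeq V :=
  ⟨fun h => by simpa using negSeq_le_negSeq h, fun h => by simpa using negSeq_le_negSeq h⟩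

@[simp] lemma negSeq_eq_zero {U : Multiset G} : negSeq U = 0 ↔ U = 0 := by
  simp [negSeq]

lemma IsMinZeroSum.neg {U : Multiset G} (hU : IsMinZeroSum U) : IsMinZeroSum (negSeq U) := by
  refine ⟨by simpa using hU.1, by simp [hU.2.1], fun T hT hT0 => ?_⟩
  rcases hU.2.2 (negSeq T) (negSeq_le_iff.mpr hT) (by simp [hT0]) with h | h
  · left; simpa using h
  · right; rw [← h]; simp

lemma IsMinZeroSum.eq_of_le {U T : Multiset G} (hU : IsMinZeroSum U) (hT : T ≤ U)
    (h0 : T.sum = 0) (hne : T ≠ 0) : T = U :=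
  (hU.2.2 T hT h0).resolve_left hne

lemma IsMinZeroSum.eq_zero_of_card_lt {U T : Multiset G} (hU : IsMinZeroSum U) (hT : T ≤ U)
    (h0 : T.sum = 0) (hc : Multiset.card T < Multiset.card U) : T = 0 :=
  (hU.2.2 T hT h0).resolve_right fun h => by rw [h] at hc; exact lt_irrefl _ hc

lemma isMinZeroSum_pair {g : G} (hg : g ≠ 0) : IsMinZeroSum ({g, -g} : Multiset G) := by
  refine ⟨by simp, by simp, fun T hT h0 => ?_⟩
  have hc := Multiset.card_le_card hT
  simp only [Multiset.insert_eq_cons, Multiset.card_cons, Multiset.card_singleton] at hc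
  interval_cases h : Multiset.card T
  · left; simpa using h
  · obtain ⟨a, rfl⟩ := Multiset.card_eq_one.mp h
    have ha : a ∈ ({g, -g} : Multiset G) := Multiset.mem_of_le hT (by simp)
    have h1 : a = 0 := by simpa using h0
    subst h1
    simp [hg, eq_comm] at ha
  · right
    exact Multiset.eq_of_le_of_card_le hT (by simp [h])

lemma exists_partition (S : Multiset G) (hS : S.sum = 0) :
    ∃ z : Multiset (Multiset G), (∀ W ∈ z, IsMinZeroSum W) ∧ z.sum = S := by
  induction hn : Multiset.card S using Nat.strong_induction_on generalizing S with
  | _ n ih =>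
    by_cases h0 : S = 0
    · exact ⟨0, by simp, by simp [h0]⟩
    by_cases hm : IsMinZeroSum S
    · exact ⟨{S}, by simpa using hm, by simp⟩
    have : ∃ T ≤ S, T.sum = 0 ∧ T ≠ 0 ∧ T ≠ S := by
      by_contra! hc
      refine hm ⟨h0, hS, fun T hT hT0 => ?_⟩
      by_cases h : T = 0
      · exact Or.inl h
      · exact Or.inr (hc T hT hT0 h)
    obtain ⟨T, hT, hT0, hne, hne'⟩ := this
    obtain ⟨R, rfl⟩ := Multiset.le_iff_exists_add.mp hT
    have hR : R ≠ 0 := fun h => hne' (by simp [h])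
    have hR0 : R.sum = 0 := by simpa [hT0] using hS
    have h1 := Multiset.card_pos.mpr hne
    have h2 := Multiset.card_pos.mpr hR
    rw [Multiset.card_add] at hn
    obtain ⟨z₁, hz₁, hs₁⟩ := ih _ (by omega) T hT0 rfl
    obtain ⟨z₂, hz₂, hs₂⟩ := ih _ (by omega) R hR0 rfl
    refine ⟨z₁ + z₂, fun W hW => ?_, by simp [hs₁, hs₂]⟩
    rcases Multiset.mem_add.mp hW with h | h
    exacts [hz₁ W h, hz₂ W h]

lemma le_sum_of_mem_partition {α : Type*} {z : Multiset (Multiset α)} {W : Multiset α} (h : W ∈ z) :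
    W ≤ z.sum := by
  obtain ⟨t, rfl⟩ := Multiset.exists_cons_of_mem h
  simp

lemma card_sum_partition {α : Type*} (z : Multiset (Multiset α)) :
    Multiset.card z.sum = (z.map Multiset.card).sum :=
  map_multiset_sum (Multiset.cardHom : Multiset α →+ ℕ) z

lemma partition_isMinZeroSum {z : Multiset (Multiset G)} {U : Multiset G} (hU : IsMinZeroSum U)
    (hz : ∀ W ∈ z, IsMinZeroSum W) (hs : z.sum = U) : z = {U} := by
  have hne : z ≠ 0 := by rintro rfl; exact hU.1 (by simpa using hs.symm)
  obtain ⟨W, hW⟩ := Multiset.exists_mem_of_ne_zero hne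
  have hWU : W = U := hU.eq_of_le (hs ▸ le_sum_of_mem_partition hW) (hz W hW).2.1 (hz W hW).1
  obtain ⟨t, rfl⟩ := Multiset.exists_cons_of_mem hW
  have ht : t.sum = 0 := by
    rw [Multiset.sum_cons, hWU] at hs
    simpa using hs
  have : t = 0 := by
    by_contra h
    obtain ⟨V, hV⟩ := Multiset.exists_mem_of_ne_zero h
    have h1 := le_sum_of_mem_partition hV
    rw [ht] at h1
    exact (hz V (Multiset.mem_cons_of_mem hV)).1 (by simpa using h1)
  rw [this, hWU]; rfl

lemma card_partition_eq_two {z : Multiset (Multiset G)} {U V : Multiset G} (hV : IsMinZeroSum V)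
    (hz : ∀ W ∈ z, IsMinZeroSum W) (hs : z.sum = U + V) (hUz : U ∈ z) : Multiset.card z = 2 := by
  obtain ⟨t, rfl⟩ := Multiset.exists_cons_of_mem hUz
  have : t = {V} := partition_isMinZeroSum hV (fun W hW => hz W (Multiset.mem_cons_of_mem hW))
    (by simpa using hs)
  simp [this]

lemma IsMinZeroSum.eq_singleton_zero {U : Multiset G} (hU : IsMinZeroSum U) (h : 0 ∈ U) :
    U = {0} :=
  (hU.eq_of_le (Multiset.singleton_le.mpr h) (by simp) (by simp)).symm

lemma IsMinZeroSum.two_le_card {U : Multiset G} (hU : IsMinZeroSum U) (h : 0 ∉ U) :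
    2 ≤ Multiset.card U := by
  by_contra! hc
  interval_cases hn : Multiset.card U
  · exact hU.1 (by simpa using hn)
  · obtain ⟨a, rfl⟩ := Multiset.card_eq_one.mp hn
    have := hU.2.1
    simp only [Multiset.sum_singleton] at this
    simp [this] at h

lemma IsMinZeroSum.zero_notMem {U : Multiset G} (hU : IsMinZeroSum U)
    (h : 2 ≤ Multiset.card U) : 0 ∉ U := by
  intro h0
  rw [hU.eq_singleton_zero h0] at h
  simp at h

/-- An atom containing 0 is `{0}`, so 0 can only be split off as a factor, and the other factor is
an atom. This isolates the only atom of length one. -/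
lemma card_partition_of_zero_mem {z : Multiset (Multiset G)} {U V : Multiset G}
    (hU : IsMinZeroSum U) (hV : IsMinZeroSum V) (hz : ∀ W ∈ z, IsMinZeroSum W)
    (hs : z.sum = U + V) (h0 : 0 ∈ U + V) : Multiset.card z = 2 := by
  wlog h : 0 ∈ U generalizing U V
  · exact this hV hU (by rw [hs, add_comm]) (by rwa [add_comm])
      ((Multiset.mem_add.mp h0).resolve_left h)
  have : ∃ W ∈ z, (0 : G) ∈ W := by
    rw [← hs, ← Multiset.join, Multiset.mem_join] at h0
    exact h0
  obtain ⟨W, hW, h0W⟩ := this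
  rw [(hz W hW).eq_singleton_zero h0W, ← hU.eq_singleton_zero h] at hW
  exact card_partition_eq_two hV hz hs hW

lemma two_mul_card_partition_le {z : Multiset (Multiset G)} (hz : ∀ W ∈ z, IsMinZeroSum W)
    (h0 : 0 ∉ z.sum) : 2 * Multiset.card z ≤ Multiset.card z.sum := by
  rw [card_sum_partition]
  have := Multiset.card_nsmul_le_sum (s := z.map Multiset.card) (a := 2) (by
    intro x hx
    obtain ⟨W, hW, rfl⟩ := Multiset.mem_map.mp hx
    exact (hz W hW).two_le_card fun h => h0 (Multiset.mem_of_le (le_sum_of_mem_partition hW) h))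
  simpa [mul_comm] using this

lemma exists_add_of_two_mem {S : Multiset G} (h : 2 ∈ partitionLengths S) :
    ∃ U V, IsMinZeroSum U ∧ IsMinZeroSum V ∧ S = U + V := by
  obtain ⟨z, hz, hs, hc⟩ := h
  obtain ⟨U, V, rfl⟩ := Multiset.card_eq_two.mp hc
  exact ⟨U, V, hz U (by simp), hz V (by simp), by rw [← hs]; simp⟩

/-- Without zeros each atom has at least two terms, so 2k ≤ |U| + |V| ≤ 2D. With a zero the only
length is 2, whence `2 ≤ D`. -/
lemma le_of_two_mem_partitionLengths {D : ℕ} (hD : 2 ≤ D)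
    (hmax : ∀ W : Multiset G, IsMinZeroSum W → Multiset.card W ≤ D) {S : Multiset G} {k : ℕ}
    (h2 : 2 ∈ partitionLengths S) (hk : k ∈ partitionLengths S) : k ≤ D := by
  obtain ⟨U, V, hU, hV, rfl⟩ := exists_add_of_two_mem h2
  obtain ⟨z, hz, hs, rfl⟩ := hk
  by_cases h0 : (0 : G) ∈ U + V
  · rwa [card_partition_of_zero_mem hU hV hz hs h0]
  · have := two_mul_card_partition_le hz (hs ▸ h0)
    have h1 := hmax U hU
    have h2 := hmax V hV
    rw [hs, Multiset.card_add] at this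
    omega

lemma eq_pair_of_card_eq_two {W : Multiset G} (h0 : W.sum = 0) (hc : Multiset.card W = 2) :
    ∃ x, W = {x, -x} := by
  obtain ⟨x, y, rfl⟩ := Multiset.card_eq_two.mp hc
  refine ⟨x, ?_⟩
  have : x + y = 0 := by simpa using h0
  rw [eq_neg_of_add_eq_zero_right this]

lemma exists_eq_add_negSeq_of_card_two {z : Multiset (Multiset G)}
    (hz : ∀ W ∈ z, W.sum = 0 ∧ Multiset.card W = 2) :
    ∃ M : Multiset G, z.sum = M + negSeq M := by
  induction z using Multiset.induction_on with
  | empty => exact ⟨0, by simp⟩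
  | cons W t ih =>
    obtain ⟨M, hM⟩ := ih fun V hV => hz V (Multiset.mem_cons_of_mem hV)
    have hW := hz W (Multiset.mem_cons_self _ _)
    obtain ⟨x, rfl⟩ := eq_pair_of_card_eq_two hW.1 hW.2
    refine ⟨x ::ₘ M, ?_⟩
    rw [Multiset.sum_cons, hM, negSeq_cons]
    simp only [Multiset.insert_eq_cons, ← Multiset.singleton_add]
    abel

/-- The equality case of the preceding bound: both factors have length D and the long factorization
consists of pairs {x, -x}. So x and -x are equally frequent in U + V, and minimality of U and V then
forces V = -U. -/
lemma exists_eq_add_negSeq {D : ℕ} (hD : 3 ≤ D)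
    (hmax : ∀ W : Multiset G, IsMinZeroSum W → Multiset.card W ≤ D) {S : Multiset G}
    (h2 : 2 ∈ partitionLengths S) (hk : D ∈ partitionLengths S) :
    ∃ U, IsMinZeroSum U ∧ Multiset.card U = D ∧ S = U + negSeq U := by
  classical
  obtain ⟨U, V, hU, hV, rfl⟩ := exists_add_of_two_mem h2
  obtain ⟨z, hz, hs, hc⟩ := hk
  have h0 : (0 : G) ∉ U + V := fun h0 => by
    have := card_partition_of_zero_mem hU hV hz hs h0
    omega
  have hle := two_mul_card_partition_le hz (hs ▸ h0)
  have h1 := hmax U hU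
  have h2 := hmax V hV
  rw [hs, Multiset.card_add] at hle
  have hcU : Multiset.card U = D := by omega
  have hcV : Multiset.card V = D := by omega
  have hall : ∀ W ∈ z, W.sum = 0 ∧ Multiset.card W = 2 := by
    intro W hW
    refine ⟨(hz W hW).2.1, ?_⟩
    obtain ⟨t, rfl⟩ := Multiset.exists_cons_of_mem hW
    have hle' := two_mul_card_partition_le (z := t)
      (fun V hV => hz V (Multiset.mem_cons_of_mem hV))
      (fun h => h0 (by rw [← hs, Multiset.sum_cons]; exact Multiset.mem_add.mpr (Or.inr h)))
    have h3 : 2 ≤ Multiset.card W := (hz W hW).two_le_card fun h =>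
      h0 (by rw [← hs, Multiset.sum_cons]; exact Multiset.mem_add.mpr (Or.inl h))
    have h4 := congrArg Multiset.card hs
    simp only [Multiset.sum_cons, Multiset.card_add, Multiset.card_cons] at h4 hc
    omega
  obtain ⟨M, hM⟩ := exists_eq_add_negSeq_of_card_two hall
  have hcount : ∀ x, U.count x + V.count x = M.count x + M.count (-x) := by
    intro x
    rw [← Multiset.count_add, ← hs, hM, Multiset.count_add, count_negSeq]
  have hpair : ∀ {T : Multiset G}, IsMinZeroSum T → Multiset.card T = D → ∀ x ∈ T,
      x ≠ -x → T.count (-x) = 0 := by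
    intro T hT hTc x hx hne
    by_contra hc
    have hx' : -x ∈ T := Multiset.count_ne_zero.mp hc
    have hle : ({x, -x} : Multiset G) ≤ T := by
      rw [Multiset.insert_eq_cons, Multiset.cons_le_of_notMem (by simpa using hne)]
      exact ⟨hx, by simpa using hx'⟩
    have := hT.eq_zero_of_card_lt hle (by simp) (by simp; omega)
    simp at this
  have hself : ∀ {T : Multiset G}, IsMinZeroSum T → Multiset.card T = D → ∀ x,
      x = -x → T.count x ≤ 1 := by
    intro T hT hTc x hne
    by_contra! hc
    have hle : Multiset.replicate 2 x ≤ T := Multiset.le_count_iff_replicate_le.mp hc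
    have := hT.eq_zero_of_card_lt hle
      (by simp only [Multiset.sum_replicate, two_nsmul]; nth_rewrite 1 [hne]; simp)
      (by simp; omega)
    simp at this
  refine ⟨U, hU, hcU, ?_⟩
  -- If x ≠ -x, then -x is not in U, so all the copies of -x that balance x lie in V. If x = -x, its
  -- multiplicity in U + V is even and at most one in each factor.
  have hUV : U ≤ negSeq V := by
    rw [Multiset.le_iff_count]
    intro x
    rw [count_negSeq]
    by_cases hx : x ∈ U
    · by_cases hne : x = -x
      · have a1 := hself hU hcU x hne
        have a2 := hself hV hcV x hne
        have a3 := hcount x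
        rw [← hne] at a3 ⊢
        have a4 := Multiset.count_pos.mpr hx
        omega
      · have a1 := hpair hU hcU x hx hne
        have a2 := hcount x
        have a3 := hcount (-x)
        rw [neg_neg] at a3
        by_cases hxV : x ∈ V
        · have a4 := hpair hV hcV x hxV hne
          have a5 := Multiset.count_pos.mpr hx
          omega
        · have a4 := Multiset.count_eq_zero.mpr hxV
          omega
    · rw [Multiset.count_eq_zero.mpr hx]; exact Nat.zero_le _
  have : U = negSeq V := Multiset.eq_of_le_of_card_le hUV (by simp [hcU, hcV])
  rw [this]; simp

lemma exists_eq_add_of_le_add {α : Type*} {W A B : Multiset α} (h : W ≤ A + B) :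
    ∃ A' ≤ A, ∃ B' ≤ B, W = A' + B' := by
  classical
  refine ⟨W ∩ A, Multiset.inter_le_right, W - A, ?_, ?_⟩
  · rw [Multiset.sub_le_iff_le_add, add_comm]; exact h
  · ext x
    simp only [Multiset.count_add, Multiset.count_inter, Multiset.count_sub]
    omega

lemma exists_eq_add_negSeq_of_le {W A B : Multiset G} (h : W ≤ A + negSeq B) :
    ∃ A' ≤ A, ∃ B' ≤ B, W = A' + negSeq B' := by
  obtain ⟨A', hA, B', hB, rfl⟩ := exists_eq_add_of_le_add h
  exact ⟨A', hA, negSeq B', negSeq_le_iff.mpr hB, by simp⟩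

/-- A shorter relation would be an equality between two disjoint single terms or a zero-sum
subsequence of U with at most two terms. -/
lemma three_le_card_of_relation {U A B : Multiset G} (hU : IsMinZeroSum U)
    (hc : 3 ≤ Multiset.card U) (hA : A ≤ U) (hB : B ≤ U) (hd : Disjoint A B)
    (hs : A.sum = B.sum) (hne : A + B ≠ 0) : 3 ≤ Multiset.card A + Multiset.card B := by
  by_contra! hlt
  by_cases hA0 : A = 0
  · subst hA0
    have := hU.eq_zero_of_card_lt hB (by simpa using hs.symm) (by omega)
    simp [this] at hne
  by_cases hB0 : B = 0
  · subst hB0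
    have := hU.eq_zero_of_card_lt hA (by simpa using hs) (by omega)
    simp [this] at hne
  have h1 := Multiset.card_pos.mpr hA0
  have h2 := Multiset.card_pos.mpr hB0
  obtain ⟨a, rfl⟩ := Multiset.card_eq_one.mp (by omega : Multiset.card A = 1)
  obtain ⟨b, rfl⟩ := Multiset.card_eq_one.mp (by omega : Multiset.card B = 1)
  simp only [Multiset.sum_singleton] at hs
  subst hs
  simp at hd

lemma add_le_of_disjoint {α : Type*} {U A B : Multiset α} (hA : A ≤ U) (hB : B ≤ U)
    (hd : Disjoint A B) :
    A + B ≤ U := by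
  classical
  rw [Multiset.add_eq_union_iff_disjoint.mpr hd]
  exact Multiset.union_le hA hB

/-- An equality of the sums of two disjoint subsequences of `U` yields a factorization of
`U + (-U)`. -/
lemma exists_length_of_relation {U A B : Multiset G} (hU : IsMinZeroSum U)
    (hc : 3 ≤ Multiset.card U) (hA : A ≤ U) (hB : B ≤ U) (hd : Disjoint A B)
    (hs : A.sum = B.sum) (hne : A + B ≠ 0) :
    ∃ p k, 1 ≤ p ∧ 3 * p ≤ Multiset.card A + Multiset.card B ∧
      k + (Multiset.card A + Multiset.card B) = Multiset.card U + 2 * p ∧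
      k ∈ partitionLengths (U + negSeq U) := by
  obtain ⟨R, rfl⟩ := Multiset.le_iff_exists_add.mp (add_le_of_disjoint hA hB hd)
  -- U(-U) consists of A(-B), its negative, and R(-R). Factor the first into p atoms, use the
  -- negatives of these for the second, and pairs {g, -g} for the third: 2p + |R| atoms.
  obtain ⟨z, hz, hzs⟩ := exists_partition (A + negSeq B) (by simp [hs])
  have hcard : ∀ W ∈ z, 3 ≤ Multiset.card W := by
    intro W hW
    obtain ⟨A', hA', B', hB', rfl⟩ :=
      exists_eq_add_negSeq_of_le (hzs ▸ le_sum_of_mem_partition hW)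
    have := three_le_card_of_relation hU hc (hA'.trans hA) (hB'.trans hB)
      (hd.mono hA' hB')
      (by simpa [add_neg_eq_zero] using (hz _ hW).2.1)
      (fun h => (hz _ hW).1 (by
        obtain ⟨h1, h2⟩ := add_eq_zero.mp h
        simp [h1, h2]))
    simpa using this
  have hsum : 3 * Multiset.card z ≤ Multiset.card A + Multiset.card B := by
    have := Multiset.card_nsmul_le_sum (s := z.map Multiset.card) (a := 3) (by
      intro x hx
      obtain ⟨W, hW, rfl⟩ := Multiset.mem_map.mp hx
      exact hcard W hW)
    rw [← card_sum_partition, hzs] at this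
    simpa [mul_comm] using this
  refine ⟨Multiset.card z, 2 * Multiset.card z + Multiset.card R, ?_, hsum, ?_, ?_⟩
  · rw [Nat.one_le_iff_ne_zero, Ne, Multiset.card_eq_zero]
    rintro rfl
    apply hne
    have h1 : A + negSeq B = 0 := by rw [← hzs]; simp
    obtain ⟨h1, h2⟩ := add_eq_zero.mp h1
    rw [h1, negSeq_eq_zero.mp h2, add_zero]
  · simp only [Multiset.card_add]; ring
  · refine ⟨z + z.map negSeq + R.map fun g => {g, -g}, ?_, ?_, ?_⟩
    · intro W hW
      rcases Multiset.mem_add.mp hW with h | h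
      · rcases Multiset.mem_add.mp h with h | h
        · exact hz W h
        · obtain ⟨V, hV, rfl⟩ := Multiset.mem_map.mp h
          exact (hz V hV).neg
      · obtain ⟨g, hg, rfl⟩ := Multiset.mem_map.mp h
        refine isMinZeroSum_pair ?_
        rintro rfl
        exact hU.zero_notMem (by omega) (Multiset.mem_add.mpr (Or.inr hg))
    · have h1 : (z.map negSeq).sum = negSeq (A + negSeq B) := by
        rw [← hzs]
        exact (map_multiset_sum (Multiset.mapAddMonoidHom (Neg.neg : G → G)) z).symm
      have h2 : (R.map fun g => ({g, -g} : Multiset G)).sum = R + negSeq R := by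
        clear * -
        induction R using Multiset.induction_on with
        | empty => simp
        | cons a s ih =>
          rw [Multiset.map_cons, Multiset.sum_cons, ih, negSeq_cons]
          simp only [Multiset.insert_eq_cons, ← Multiset.singleton_add]
          abel
      rw [Multiset.sum_add, Multiset.sum_add, hzs, h1, h2]
      simp only [negSeq_add, negSeq_negSeq]
      abel
    · simp; ring

/-- If `U + (-U)` has a factorization whose length is neither `2` nor `|U|`, then there is an atom
that mixes terms of `U` and of `-U`. -/
lemma exists_mixed_isMinZeroSum {U : Multiset G} (hU : IsMinZeroSum U)
    (hc : 3 ≤ Multiset.card U) {k : ℕ} (hk : k ∈ partitionLengths (U + negSeq U)) (hk2 : k ≠ 2)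
    (hkU : k ≠ Multiset.card U) :
    ∃ A ≤ U, ∃ B ≤ U, Disjoint A B ∧ A ≠ 0 ∧ B ≠ 0 ∧ A.sum = B.sum ∧ A + negSeq B ≠ U := by
  classical
  obtain ⟨z, hz, hzs, rfl⟩ := hk
  have h0 := hU.zero_notMem (by omega)
  -- If all atoms had length two, there would be |U| of them.
  have : ∃ W ∈ z, Multiset.card W ≠ 2 := by
    by_contra! h
    apply hkU
    have h1 := card_sum_partition z
    rw [Multiset.map_congr rfl h, hzs] at h1
    simp at h1
    omega
  obtain ⟨W, hW, hW2⟩ := this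
  have hWle : W ≤ U + negSeq U := hzs ▸ le_sum_of_mem_partition hW
  have hWU : W ≠ U := by
    rintro rfl
    exact hk2 (card_partition_eq_two hU.neg hz hzs hW)
  have hWU' : W ≠ negSeq U := by
    rintro rfl
    exact hk2 (card_partition_eq_two hU hz (by rw [hzs, add_comm]) hW)
  obtain ⟨A, hA, B, hB, rfl⟩ := exists_eq_add_negSeq_of_le hWle
  have hs : A.sum = B.sum := by simpa [add_neg_eq_zero] using (hz _ hW).2.1
  refine ⟨A, hA, B, hB, ?_, ?_, ?_, hs, hWU⟩
  -- A common term x would put the pair {x, -x} inside the atom, which would then have length two.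
  · rw [Multiset.disjoint_left]
    intro x hxA hxB
    apply hW2
    have hle : ({x, -x} : Multiset G) ≤ A + negSeq B := by
      have : ({x, -x} : Multiset G) = {x} + {-x} := rfl
      rw [this]
      exact add_le_add (by simpa using hxA) (by simpa using hxB)
    rw [← (hz _ hW).eq_of_le hle (by simp) (by simp)]
    simp
  · rintro rfl
    apply hWU'
    have hB0 : B ≠ 0 := fun h => (hz _ hW).1 (by simp [h])
    rw [hU.eq_of_le hB (by simpa using hs.symm) hB0]; simp
  · rintro rfl
    apply hWU
    have hB0 : A ≠ 0 := fun h => (hz _ hW).1 (by simp [h])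
    rw [hU.eq_of_le hA (by simpa using hs) hB0]; simp

/-- A sequence at least as long as every atom contains a non-empty zero-sum subsequence. -/
lemma exists_zeroSum_of_le_card {D : ℕ}
    (hmax : ∀ W : Multiset G, IsMinZeroSum W → Multiset.card W ≤ D) {S : Multiset G}
    (hS : D ≤ Multiset.card S) : ∃ T ≤ S, T ≠ 0 ∧ T.sum = 0 := by
  by_contra! h
  -- If S has no zero-sum subsequence, adjoining the negative of its sum gives an atom with more
  -- than D terms.
  have : IsMinZeroSum (-S.sum ::ₘ S) := by
    refine ⟨by simp, by simp, fun T hT hT0 => ?_⟩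
    by_cases hm : -S.sum ∈ T
    · obtain ⟨R, rfl⟩ := Multiset.exists_cons_of_mem hm
      right
      have hR := (Multiset.cons_le_cons_iff _).mp hT
      obtain ⟨Q, rfl⟩ := Multiset.le_iff_exists_add.mp hR
      have hQ : Q.sum = 0 := by
        rw [Multiset.sum_cons, Multiset.sum_add] at hT0
        have : -Q.sum = 0 := by rw [← hT0]; abel
        simpa using this
      have : Q = 0 := by
        by_contra hne
        exact h Q (by simp) hne hQ
      simp [this]
    · left
      by_contra hne
      exact h T ((Multiset.le_cons_of_notMem hm).mp hT) hne hT0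
  have := hmax _ this
  simp at this
  omega

/-- If `U` is an atom of maximal length, then every group element is the sum of a subsequence of
`U` that avoids a given term. -/
lemma exists_sum_eq {D : ℕ} (hmax : ∀ W : Multiset G, IsMinZeroSum W → Multiset.card W ≤ D)
    {U : Multiset G} (hU : IsMinZeroSum U) (hc : Multiset.card U = D) {h : G} {R : Multiset G}
    (hR : U = h ::ₘ R) (x : G) : ∃ Y ≤ R, Y.sum = x := by
  -- `R` has D - 1 terms, so `-x ::ₘ R` is just long enough; its zero-sum subsequence must use `-x`,
  -- as `R` lies properly in an atom.
  obtain ⟨T, hT, hne, hT0⟩ := exists_zeroSum_of_le_card hmax (S := -x ::ₘ R)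
    (by rw [← hc, hR]; simp)
  by_cases hm : -x ∈ T
  · obtain ⟨Y, rfl⟩ := Multiset.exists_cons_of_mem hm
    refine ⟨Y, (Multiset.cons_le_cons_iff _).mp hT, ?_⟩
    rw [Multiset.sum_cons] at hT0
    rw [← sub_eq_zero, ← hT0]; abel
  · exfalso
    have hTR := (Multiset.le_cons_of_notMem hm).mp hT
    refine hne (hU.eq_zero_of_card_lt (hTR.trans (by rw [hR]; exact Multiset.le_cons_self _ _))
      hT0 ?_)
    have := Multiset.card_le_card hTR
    rw [hR, Multiset.card_cons]; omega

/-- In an atom `U` of maximal length, a term `g` is the sum of a subsequence that contains a given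
other term but not `g`. -/
lemma exists_sum_eq_term {D : ℕ} (hmax : ∀ W : Multiset G, IsMinZeroSum W → Multiset.card W ≤ D)
    {U : Multiset G} (hU : IsMinZeroSum U) (hc : Multiset.card U = D) {g h : G}
    (hh : h ∈ U) (hgh : g ≠ h) : ∃ Y ≤ U, h ∈ Y ∧ g ∉ Y ∧ Y.sum = g := by
  obtain ⟨R, hR⟩ := Multiset.exists_cons_of_mem hh
  -- Represent g - h without one copy of h, then put that copy back. If g occurred too, deleting it
  -- would leave a proper zero-sum subsequence containing h.
  obtain ⟨Y, hY, hs⟩ := exists_sum_eq hmax hU hc hR (g - h)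
  have hle : h ::ₘ Y ≤ U := hR ▸ (Multiset.cons_le_cons_iff h).mpr hY
  refine ⟨h ::ₘ Y, hle, by simp, fun hm => ?_, by simp [hs]⟩
  have hgY : g ∈ Y := (Multiset.mem_cons.mp hm).resolve_left hgh
  obtain ⟨Q, rfl⟩ := Multiset.exists_cons_of_mem hgY
  have h1 : (h ::ₘ Q).sum = 0 := by
    rw [Multiset.sum_cons] at hs ⊢
    have := congrArg (fun x => x + h - g) hs
    simp only [sub_add_cancel, sub_self] at this
    rw [← this]; abel
  have h2 : h ::ₘ Q ≤ U :=
    le_trans ((Multiset.cons_le_cons_iff h).mpr (Multiset.le_cons_self _ _)) hle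
  have := hU.eq_zero_of_card_lt h2 h1
    (lt_of_lt_of_le (by simp) (Multiset.card_le_card hle))
  simp at this

end Sequences
end SetsOfLengths
namespace SetsOfLengths

/-! ### The case L(U(-U)) = {2, D-1, D} -/

section RankTwo

variable {G : Type*} [AddCommGroup G]

lemma IsMinZeroSum.add_ne_zero {U : Multiset G} (hU : IsMinZeroSum U)
    (hc : 3 ≤ Multiset.card U) {x y : G} (h : {x, y} ≤ U) : x + y ≠ 0 := by
  intro h0
  have := hU.eq_zero_of_card_lt h (by simpa using h0) (by simp; omega)
  simp at this

lemma pair_le_of_ne {α : Type*} {U : Multiset α} {x y : α} (hx : x ∈ U) (hy : y ∈ U)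
    (hxy : x ≠ y) : ({x, y} : Multiset α) ≤ U := by
  rw [Multiset.insert_eq_cons, Multiset.cons_le_of_notMem (by simpa using hxy)]
  exact ⟨hx, by simpa using hy⟩

lemma triple_le_of_ne {α : Type*} {U : Multiset α} {x y w : α} (hx : x ∈ U) (hy : y ∈ U)
    (hw : w ∈ U) (hxy : x ≠ y) (hxw : x ≠ w) (hyw : y ≠ w) :
    ({x, y, w} : Multiset α) ≤ U := by
  rw [Multiset.insert_eq_cons, Multiset.cons_le_of_notMem (by simp [hxy, hxw])]
  exact ⟨hx, pair_le_of_ne hy hw hyw⟩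

lemma IsMinZeroSum.count_le_one [DecidableEq G] {U : Multiset G} (hU : IsMinZeroSum U)
    (hc : 3 ≤ Multiset.card U) {x : G} (h : x + x = 0) : U.count x ≤ 1 := by
  by_contra! hlt
  exact hU.add_ne_zero hc (x := x) (y := x) (Multiset.le_count_iff_replicate_le.mp hlt) h

/-- A factorization of `U + (-U)` whose length is neither `2` nor `|U|` excludes that all terms of
`U` have order two. -/
lemma exists_add_self_ne_zero {U : Multiset G} (hU : IsMinZeroSum U)
    (hc : 3 ≤ Multiset.card U) {k : ℕ} (hk : k ∈ partitionLengths (U + negSeq U)) (hk2 : k ≠ 2)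
    (hkU : k ≠ Multiset.card U) : ∃ g ∈ U, g + g ≠ 0 := by
  obtain ⟨A, hA, B, hB, hdAB, hA0, hB0, hABs, hABU⟩ := exists_mixed_isMinZeroSum hU hc hk hk2 hkU
  by_contra! hall
  apply hABU
  -- With only terms of order two, A(-B) = AB is a zero-sum subsequence of U, hence U itself.
  have hBn : negSeq B = B := by
    have : B.map Neg.neg = B.map id := Multiset.map_congr rfl fun x hx =>
      neg_eq_iff_add_eq_zero.mpr (hall x (Multiset.mem_of_le hB hx))
    simpa [negSeq] using this
  rw [hBn]
  refine hU.eq_of_le (add_le_of_disjoint hA hB hdAB) ?_ (fun h => hA0 (add_eq_zero.mp h).1)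
  rw [Multiset.sum_add, ← hBn, sum_negSeq, hABs, add_neg_cancel]

/-- A factorization of `U + (-U)` whose length is neither `2` nor `|U|` excludes that all terms of
`U` are equal. -/
lemma exists_mem_ne {U : Multiset G} (hU : IsMinZeroSum U)
    (hc : 3 ≤ Multiset.card U) {k : ℕ} (hk : k ∈ partitionLengths (U + negSeq U)) (hk2 : k ≠ 2)
    (hkU : k ≠ Multiset.card U) (g : G) : ∃ h ∈ U, h ≠ g := by
  obtain ⟨A, hA, B, hB, hdAB, hA0, hB0, -, -⟩ := exists_mixed_isMinZeroSum hU hc hk hk2 hkU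
  by_contra! hall
  obtain ⟨a, ha⟩ := Multiset.exists_mem_of_ne_zero hA0
  obtain ⟨b, hb⟩ := Multiset.exists_mem_of_ne_zero hB0
  rw [hall a (Multiset.mem_of_le hA ha)] at ha
  rw [hall b (Multiset.mem_of_le hB hb)] at hb
  exact (Multiset.disjoint_left.mp hdAB) ha hb

/-- Two elements `g` and `e` generate `C₂ ⊕ C_m`. -/
lemma nonempty_addEquiv_zmod_two_prod {m : ℕ} (hm : 0 < m) {g e : G} (he : e + e = 0)
    (hg : m • g = 0) (hord : ∀ i, 0 < i → i < m → i • g ≠ 0) (hne : ∀ i < m, i • g ≠ e)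
    (hgen : ∀ x : G, ∃ i j : ℕ, x = i • g + j • e) : Nonempty (G ≃+ ZMod 2 × ZMod m) := by
  have : NeZero m := ⟨hm.ne'⟩
  let f : ZMod 2 × ZMod m →+ G := AddMonoidHom.coprod
    (ZMod.lift 2 ⟨zmultiplesHom G e, by simp [two_zsmul, he]⟩)
    (ZMod.lift m ⟨zmultiplesHom G g, by simp [hg]⟩)
  have hf : ∀ i j : ℕ, f ((j : ZMod 2), (i : ZMod m)) = i • g + j • e := by
    intro i j
    have h1 : ZMod.lift 2 ⟨zmultiplesHom G e, by simp [two_zsmul, he]⟩ ((j : ℤ) : ZMod 2)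
        = j • e := by
      rw [ZMod.lift_coe]; simp
    have h2 : ZMod.lift m ⟨zmultiplesHom G g, by simp [hg]⟩ ((i : ℤ) : ZMod m) = i • g := by
      rw [ZMod.lift_coe]; simp
    rw [Int.cast_natCast] at h1 h2
    simp only [f, AddMonoidHom.coprod_apply]
    rw [h1, h2, add_comm]
  refine ⟨(AddEquiv.ofBijective f ⟨?_, ?_⟩).symm⟩
  · rw [injective_iff_map_eq_zero]
    rintro ⟨a, b⟩ hab
    have ha := ZMod.natCast_zmod_val a
    have hb := ZMod.natCast_zmod_val b
    have hal := ZMod.val_lt a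
    have hbl := ZMod.val_lt b
    rw [← ha, ← hb, hf] at hab
    rw [← ha, ← hb]
    generalize a.val = j at *
    generalize b.val = i at *
    interval_cases j
    · have : i = 0 := by
        by_contra h
        exact hord i (Nat.pos_of_ne_zero h) hbl (by simpa using hab)
      simp [this]
    · exfalso
      apply hne i hbl
      rw [one_nsmul] at hab
      rw [eq_neg_of_add_eq_zero_left hab, neg_eq_iff_add_eq_zero, he]
  · intro x
    obtain ⟨i, j, rfl⟩ := hgen x
    exact ⟨_, hf i j⟩

/-- With w the weight and k the length, k + w = D + 2p and 3p ≤ w ≤ D. Here k = D is impossible, k =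
D-1 forces p = 1 and w = 3, and k = 2 forces w = D. -/
lemma card_add_card_of_relation {D : ℕ} {U : Multiset G} (hD : 5 ≤ D) (hU : IsMinZeroSum U)
    (hc : Multiset.card U = D)
    (hL : ∀ k ∈ partitionLengths (U + negSeq U), k = 2 ∨ k = D - 1 ∨ k = D) {A B : Multiset G}
    (hA : A ≤ U) (hB : B ≤ U) (hd : Disjoint A B) (hs : A.sum = B.sum) (hne : A + B ≠ 0) :
    Multiset.card A + Multiset.card B = 3 ∨ Multiset.card A + Multiset.card B = D := by
  obtain ⟨p, k, hp, h3, hk, hkL⟩ := exists_length_of_relation hU (by omega) hA hB hd hs hne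
  have hle := Multiset.card_le_card (add_le_of_disjoint hA hB hd)
  rw [Multiset.card_add] at hle
  rcases hL k hkL with h | h | h <;> omega

/-- Here U = g^(D-2)(g+e)e, so its sum being 0 says (D-1)g = 0. By minimality g has order D-1, and
weights of relations show that e is not a multiple of g. -/
lemma nonempty_addEquiv_of_support [DecidableEq G] {D : ℕ} {U : Multiset G} (hD : 5 ≤ D)
    (hmax : ∀ W : Multiset G, IsMinZeroSum W → Multiset.card W ≤ D) (hU : IsMinZeroSum U)
    (hc : Multiset.card U = D)
    (hL : ∀ k ∈ partitionLengths (U + negSeq U), k = 2 ∨ k = D - 1 ∨ k = D) {g h e : G}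
    (he : e + e = 0) (hgh : h = g + e) (hg : g ∈ U) (hh : h ∈ U) (heU : e ∈ U)
    (hge : g + g ≠ 0) (hhU : U.count h = 1) (hsupp : ∀ x ∈ U, x = g ∨ x = h ∨ x = e) :
    Nonempty (G ≃+ ZMod 2 × ZMod (D - 1)) := by
  have he0 : e ≠ 0 := fun h0 => hU.zero_notMem (by omega) (h0 ▸ heU)
  have hgne : g ≠ h := fun h0 => he0 (by rw [← h0] at hgh; simpa using hgh)
  have hgee : g ≠ e := fun h0 => hge (h0 ▸ he)
  have hhe : h ≠ e := by
    rintro rfl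
    exact hge (by rw [right_eq_add] at hgh; simp [hgh])
  have heU1 : U.count e = 1 := le_antisymm (hU.count_le_one (by omega) he)
    (Multiset.one_le_count_iff_mem.mpr heU)
  have hUeq : U = Multiset.replicate (U.count g) g + {h, e} := by
    ext x
    rw [Multiset.count_add, Multiset.count_replicate, Multiset.insert_eq_cons,
      Multiset.count_cons, Multiset.count_singleton]
    by_cases hx : x ∈ U
    · rcases hsupp x hx with rfl | rfl | rfl
      · simp [hgne, hgee]
      · simp [hgne, hhe, hhU]
      · simp [hgee, hhe.symm, heU1]
    · rw [Multiset.count_eq_zero.mpr hx]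
      have h1 : g ≠ x := fun h => hx (h ▸ hg)
      have h2 : x ≠ h := fun h' => hx (h' ▸ hh)
      have h3 : x ≠ e := fun h' => hx (h' ▸ heU)
      simp [h1, h2, h3]
  have hcg : U.count g = D - 2 := by
    have := congrArg Multiset.card hUeq
    simp at this
    omega
  rw [hcg] at hUeq
  have hrep : ∀ i ≤ D - 2, Multiset.replicate i g ≤ U := fun i hi =>
    Multiset.le_count_iff_replicate_le.mp (by omega)
  have hsum : (D - 1) • g = 0 := by
    have h1 := hU.2.1
    rw [hUeq] at h1
    simp only [Multiset.sum_add, Multiset.sum_replicate, Multiset.insert_eq_cons,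
      Multiset.sum_cons, Multiset.sum_singleton, hgh] at h1
    rw [show D - 1 = D - 2 + 1 by omega, succ_nsmul]
    have : (D - 2) • g + (g + e + e) = (D - 2) • g + g + (e + e) := by abel
    rw [this, he, add_zero] at h1
    exact h1
  have hord : ∀ i, 0 < i → i < D - 1 → i • g ≠ 0 := by
    intro i hi0 hi h0
    have := hU.eq_zero_of_card_lt (hrep i (by omega)) (by simpa using h0) (by simp; omega)
    have := congrArg Multiset.card this
    simp at this
    omega
  refine nonempty_addEquiv_zmod_two_prod (by omega) he hsum hord ?_ ?_
  · intro i hi hie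
    have hi0 : 0 < i := Nat.pos_of_ne_zero fun h0 => he0 (by rw [← hie, h0]; simp)
    have h1 := card_add_card_of_relation hD hU hc hL (hrep i (by omega))
      (Multiset.singleton_le.mpr heU) (by simp [Multiset.mem_replicate, hgee.symm])
      (by simpa using hie) (by simp)
    simp only [Multiset.card_replicate, Multiset.card_singleton] at h1
    -- The weight i + 1 is 3 or D, and i < D - 1. Then 4g = 2e = 0, which contradicts the order of g
    -- if D > 5; for D = 5 it gives g + h = 4g = 0 inside U.
    obtain rfl : i = 2 := by omega
    have h4 : 4 • g = 0 := by
      rw [← hie] at he; rw [← he, ← add_nsmul]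
    by_cases hD5 : D = 5
    · refine hU.add_ne_zero (by omega) (pair_le_of_ne hg hh hgne) ?_
      rw [hgh, ← hie, ← h4]; abel
    · exact hord 4 (by omega) (by omega) h4
  · intro x
    obtain ⟨R, hR⟩ := Multiset.exists_cons_of_mem hg
    obtain ⟨Y, hY, hYs⟩ := exists_sum_eq hmax hU hc hR x
    -- Each copy of h = g + e counts once for g and once for e.
    refine ⟨Y.count g + Y.count h, Y.count h + Y.count e, ?_⟩
    have hYU : ∀ y ∈ Y, y = g ∨ y = h ∨ y = e := fun y hy => hsupp y
      (by rw [hR]; exact Multiset.mem_cons_of_mem (Multiset.mem_of_le hY hy))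
    rw [← hYs]
    clear hYs hY
    induction Y using Multiset.induction_on with
    | empty => simp
    | cons a s ih =>
      rw [Multiset.sum_cons, ih fun y hy => hYU y (Multiset.mem_cons_of_mem hy)]
      simp only [Multiset.count_cons]
      rcases hYU a (Multiset.mem_cons_self a s) with rfl | rfl | rfl
      · simp only [if_true, if_neg hgne.symm, if_neg hgee.symm, add_zero, add_nsmul, one_nsmul]
        abel
      · simp only [if_true, if_neg hgne, if_neg hhe.symm, add_zero, add_nsmul, one_nsmul]
        nth_rewrite 1 [hgh]; abel
      · simp only [if_true, if_neg hhe, if_neg hgee, add_zero, add_nsmul, one_nsmul]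
        abel

/-- An atom `U` of maximal length `D` with `L(U(-U)) = {2, D - 1, D}` forces
`G ≅ C₂ ⊕ C_{D-1}`. -/
theorem nonempty_addEquiv_zmod_two_prod_of_lengths {D : ℕ} {U : Multiset G} (hD : 5 ≤ D)
    (hmax : ∀ W : Multiset G, IsMinZeroSum W → Multiset.card W ≤ D) (hU : IsMinZeroSum U)
    (hc : Multiset.card U = D)
    (hL : ∀ k ∈ partitionLengths (U + negSeq U), k = 2 ∨ k = D - 1 ∨ k = D)
    (hmem : D - 1 ∈ partitionLengths (U + negSeq U)) :
    Nonempty (G ≃+ ZMod 2 × ZMod (D - 1)) := by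
  classical
  have hc3 : 3 ≤ Multiset.card U := by omega
  have h0 : (0 : G) ∉ U := hU.zero_notMem (by omega)
  -- The relation g = σ(Y) with h in Y has weight 3 or D. Weight D would mean U = gY and 2g = 0, so
  -- Y has two terms, h and some k.
  have dich : ∀ g ∈ U, ∀ h ∈ U, g ≠ h → g + g ≠ 0 → ∃ k ∈ U, g = h + k := by
    intro g hg h hh hgh hgg
    obtain ⟨Y, hY, hhY, hgY, hYs⟩ := exists_sum_eq_term hmax hU hc hh hgh
    have hd : Disjoint {g} Y := by simpa using hgY
    have hw := card_add_card_of_relation hD hU hc hL (Multiset.singleton_le.mpr hg) hY hd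
      (by simp [hYs]) (by simp)
    rw [Multiset.card_singleton] at hw
    rcases hw with hw | hw
    · obtain ⟨Z, rfl⟩ := Multiset.exists_cons_of_mem hhY
      rw [Multiset.card_cons] at hw
      obtain ⟨k, rfl⟩ := Multiset.card_eq_one.mp (by omega : Multiset.card Z = 1)
      exact ⟨k, Multiset.mem_of_le hY (by simp), by simpa using hYs.symm⟩
    · exfalso
      apply hgg
      have : {g} + Y = U := Multiset.eq_of_le_of_card_le
        (add_le_of_disjoint (Multiset.singleton_le.mpr hg) hY hd) (by simp [hc]; omega)
      have h1 := hU.2.1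
      rw [← this, Multiset.sum_add, hYs] at h1
      simpa using h1
  obtain ⟨g, hg, hgg⟩ := exists_add_self_ne_zero hU hc3 hmem (by omega) (by omega)
  have hoth : ∀ e ∈ U, e + e = 0 → ∃ k ∈ U, k ≠ g ∧ k + k ≠ 0 ∧ g = e + k := by
    intro e he hee
    obtain ⟨k, hk, hgk⟩ := dich g hg e he (fun h => hgg (h ▸ hee)) hgg
    refine ⟨k, hk, ?_, ?_, hgk⟩
    · rintro rfl
      exact h0 (by rw [right_eq_add] at hgk; rwa [hgk] at he)
    · intro hkk
      apply hgg
      rw [hgk, show e + k + (e + k) = (e + e) + (k + k) by abel, hee, hkk, add_zero]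
  have hex2 : ∃ h ∈ U, h ≠ g ∧ h + h ≠ 0 := by
    obtain ⟨h, hh, hhg⟩ := exists_mem_ne hU hc3 hmem (by omega) (by omega) g
    by_cases hhh : h + h = 0
    · obtain ⟨k, hk, h1, h2, -⟩ := hoth h hh hhh
      exact ⟨k, hk, h1, h2⟩
    · exact ⟨h, hh, hhg, hhh⟩
  -- Both x - y and y - x are terms of U; being opposite, they must be the same term, of order two.
  have hdiff : ∀ x ∈ U, ∀ y ∈ U, x ≠ y → x + x ≠ 0 → y + y ≠ 0 →
      ∃ e ∈ U, e + e = 0 ∧ x = y + e := by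
    intro x hx y hy hxy hxx hyy
    obtain ⟨k, hk, hxk⟩ := dich x hx y hy hxy hxx
    obtain ⟨l, hl, hyl⟩ := dich y hy x hx hxy.symm hyy
    have hkl : k + l = 0 := by
      rw [hxk, add_assoc, left_eq_add] at hyl
      exact hyl
    by_cases h : k = l
    · subst h; exact ⟨k, hk, hkl, hxk⟩
    · exact absurd hkl (hU.add_ne_zero hc3 (pair_le_of_ne hk hl h))
  obtain ⟨h, hh, hhg, hhh⟩ := hex2
  obtain ⟨e, he, hee, hhe⟩ := hdiff h hh g hg hhg hhh hgg
  have hghe : g = h + e := by rw [hhe, add_assoc, hee, add_zero]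
  -- A third such term would produce three distinct terms of order two with sum 0, too short for U.
  have hthird : ∀ x ∈ U, x + x ≠ 0 → x = g ∨ x = h := by
    intro x hx hxx
    by_contra! hcon
    obtain ⟨e₁, he₁, hee₁, hx₁⟩ := hdiff x hx g hg hcon.1 hxx hgg
    obtain ⟨e₂, he₂, hee₂, hx₂⟩ := hdiff x hx h hh hcon.2 hxx hhh
    have hsum : e₁ = e + e₂ := by
      have : g + e₁ = g + (e + e₂) := by rw [← hx₁, hx₂, hhe]; abel
      exact add_left_cancel this
    have n1 : e ≠ e₁ := by
      rintro rfl; exact hcon.2 (hx₁.trans hhe.symm)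
    have n2 : e ≠ e₂ := by
      rintro rfl; exact hcon.1 (hx₂.trans hghe.symm)
    have n3 : e₁ ≠ e₂ := by
      rintro rfl
      rw [right_eq_add] at hsum
      exact h0 (hsum ▸ he)
    have := hU.eq_zero_of_card_lt (triple_le_of_ne he he₁ he₂ n1 n2 n3) (by
      simp only [Multiset.insert_eq_cons, Multiset.sum_cons, Multiset.sum_singleton]
      rw [hsum, show e + (e + e₂ + e₂) = (e + e) + (e₂ + e₂) by abel, hee, hee₂, add_zero])
      (by simp; omega)
    simp at this
  have hsupp : ∀ x ∈ U, x = g ∨ x = h ∨ x = e := by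
    intro x hx
    by_cases hxx : x + x = 0
    · obtain ⟨k, hk, hkg, hkk, hgk⟩ := hoth x hx hxx
      have hkh : k = h := (hthird k hk hkk).resolve_left hkg
      right; right
      rw [hkh, hhe, show x + (g + e) = g + (x + e) by abel, left_eq_add] at hgk
      rw [eq_neg_of_add_eq_zero_left hgk, neg_eq_iff_add_eq_zero, hee]
    · exact (hthird x hx hxx).imp_right Or.inl
  have hg1 := Multiset.one_le_count_iff_mem.mpr hg
  have hh1 := Multiset.one_le_count_iff_mem.mpr hh
  by_cases hch : U.count h = 1
  · exact nonempty_addEquiv_of_support hD hmax hU hc hL hee hhe hg hh he hgg hch hsupp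
  by_cases hcg : U.count g = 1
  · exact nonempty_addEquiv_of_support hD hmax hU hc hL hee hghe hh hg he hhh hcg
      fun x hx => by rcases hsupp x hx with h | h | h <;> simp [h]
  -- If g and h both occurred twice, 2g = 2h would be a relation of weight 4, which is neither 3 nor
  -- D.
  exfalso
  have := card_add_card_of_relation hD hU hc hL (A := Multiset.replicate 2 g)
    (B := Multiset.replicate 2 h) (Multiset.le_count_iff_replicate_le.mp (by omega))
    (Multiset.le_count_iff_replicate_le.mp (by omega))
    (by
      rw [Multiset.disjoint_left]
      intro a ha hb
      rw [Multiset.eq_of_mem_replicate ha] at hb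
      exact hhg (Multiset.eq_of_mem_replicate hb).symm)
    (by
      simp only [Multiset.sum_replicate, two_nsmul]
      rw [hhe, show g + e + (g + e) = g + g + (e + e) by abel, hee, add_zero]) (by
      intro h
      have := congrArg Multiset.card h
      simp at this)
  simp at this
  omega

end RankTwo
end SetsOfLengths
namespace SetsOfLengths

/-! ### The case L(U(-U)) = {2, 4, D} -/

section LargeRank

variable {G : Type*} [AddCommGroup G]

lemma exists_le_card_eq {α : Type*} {S : Multiset α} {n : ℕ} (h : n ≤ Multiset.card S) :
    ∃ R ≤ S, Multiset.card R = n := by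
  have : Multiset.powersetCard n S ≠ 0 := by
    rw [Ne, ← Multiset.card_eq_zero, Multiset.card_powersetCard]
    exact (Nat.choose_pos h).ne'
  obtain ⟨R, hR⟩ := Multiset.exists_mem_of_ne_zero this
  exact ⟨R, Multiset.mem_powersetCard.mp hR⟩

/-- The same count as before: k = 4 gives w = D-2 (p = 1) or w = D (p = 2), and k = 2 gives w = D.
-/
lemma card_add_card_of_relation' {D : ℕ} {U : Multiset G} (hD : 6 ≤ D) (hU : IsMinZeroSum U)
    (hc : Multiset.card U = D)
    (hL : ∀ k ∈ partitionLengths (U + negSeq U), k = 2 ∨ k = 4 ∨ k = D) {A B : Multiset G}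
    (hA : A ≤ U) (hB : B ≤ U) (hd : Disjoint A B) (hs : A.sum = B.sum) (hne : A + B ≠ 0) :
    Multiset.card A + Multiset.card B = D - 2 ∨ Multiset.card A + Multiset.card B = D := by
  obtain ⟨p, k, hp, h3, hk, hkL⟩ := exists_length_of_relation hU (by omega) hA hB hd hs hne
  have hle := Multiset.card_le_card (add_le_of_disjoint hA hB hd)
  rw [Multiset.card_add] at hle
  rcases hL k hkL with h | h | h <;> omega

/-- Cancelling the common part of A and B leaves a relation of weight below D-2, which must be
empty. -/
lemma eq_of_sum_eq_of_card_lt {D : ℕ} {U : Multiset G} (hD : 6 ≤ D) (hU : IsMinZeroSum U)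
    (hc : Multiset.card U = D)
    (hL : ∀ k ∈ partitionLengths (U + negSeq U), k = 2 ∨ k = 4 ∨ k = D) {A B : Multiset G}
    (hA : A ≤ U) (hB : B ≤ U) (hs : A.sum = B.sum)
    (hlt : Multiset.card A + Multiset.card B < D - 2) : A = B := by
  classical
  by_contra hne
  have h1 : A - B + A ∩ B = A := Multiset.sub_add_inter A B
  have h2 : B - A + A ∩ B = B := by rw [Multiset.inter_comm]; exact Multiset.sub_add_inter B A
  have hs' : (A - B).sum = (B - A).sum := by
    have h3 := congrArg Multiset.sum h1
    have h4 := congrArg Multiset.sum h2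
    rw [Multiset.sum_add] at h3 h4
    exact add_right_cancel (h3.trans (hs.trans h4.symm))
  have hd : Disjoint (A - B) (B - A) := by
    rw [Multiset.disjoint_left]
    intro x hx hy
    rw [← Multiset.count_pos, Multiset.count_sub] at hx hy
    omega
  have hne' : A - B + (B - A) ≠ 0 := by
    intro h
    obtain ⟨h3, h4⟩ := add_eq_zero.mp h
    rw [h3, zero_add] at h1
    rw [h4, zero_add] at h2
    exact hne (h1.symm.trans h2)
  have hcA := Multiset.card_le_card (Multiset.sub_le_self A B)
  have hcB := Multiset.card_le_card (Multiset.sub_le_self B A)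
  have := card_add_card_of_relation' hD hU hc hL ((Multiset.sub_le_self A B).trans hA)
    ((Multiset.sub_le_self B A).trans hB) hd hs' hne'
  omega

/-- The possible shapes of `U` around a term `g` that is not of order two. -/
lemma exists_eq_cons_cons_cons {D : ℕ} {U : Multiset G} (hD : 6 ≤ D)
    (hmax : ∀ W : Multiset G, IsMinZeroSum W → Multiset.card W ≤ D) (hU : IsMinZeroSum U)
    (hc : Multiset.card U = D)
    (hL : ∀ k ∈ partitionLengths (U + negSeq U), k = 2 ∨ k = 4 ∨ k = D) {g h : G} (hg : g ∈ U)
    (hh : h ∈ U) (hgh : g ≠ h) (hgg : g + g ≠ 0) :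
    ∃ l l' Y, U = g ::ₘ l ::ₘ l' ::ₘ Y ∧ g ∉ Y ∧ h ∈ Y ∧ g + g + (l + l') = 0 := by
  obtain ⟨Y, hY, hhY, hgY, hYs⟩ := exists_sum_eq_term hmax hU hc hh hgh
  have hd : Disjoint {g} Y := by simpa using hgY
  have hw := card_add_card_of_relation' hD hU hc hL (Multiset.singleton_le.mpr hg) hY hd
    (by simp [hYs]) (by simp)
  rw [Multiset.card_singleton] at hw
  obtain ⟨R, hR⟩ := Multiset.le_iff_exists_add.mp
    (add_le_of_disjoint (Multiset.singleton_le.mpr hg) hY hd)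
  have hUc := hc
  rw [hR, Multiset.card_add, Multiset.card_add, Multiset.card_singleton] at hUc
  have hUs := hU.2.1
  rw [hR, Multiset.sum_add, Multiset.sum_add, hYs, Multiset.sum_singleton] at hUs
  -- Weight D-2 leaves exactly two terms l, l' outside gY, and the sum of U becomes 2g + l + l'.
  -- Weight D leaves none, so 2g = 0.
  rcases hw with hw | hw
  · obtain ⟨l, l', rfl⟩ := Multiset.card_eq_two.mp (by omega : Multiset.card R = 2)
    refine ⟨l, l', Y, ?_, hgY, hhY, by simpa using hUs⟩
    rw [hR]
    simp only [Multiset.insert_eq_cons, ← Multiset.singleton_add]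
    abel
  · exfalso
    have : R = 0 := Multiset.card_eq_zero.mp (by omega)
    rw [this] at hUs
    exact hgg (by simpa using hUs)

lemma count_le_three [DecidableEq G] {D : ℕ} {U : Multiset G} (hD : 6 ≤ D)
    (hmax : ∀ W : Multiset G, IsMinZeroSum W → Multiset.card W ≤ D) (hU : IsMinZeroSum U)
    (hc : Multiset.card U = D)
    (hL : ∀ k ∈ partitionLengths (U + negSeq U), k = 2 ∨ k = 4 ∨ k = D)
    (hne : ∀ g, ∃ h ∈ U, h ≠ g) (g : G) : U.count g ≤ 3 := by
  by_cases hg : g ∈ U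
  · by_cases hgg : g + g = 0
    · exact (hU.count_le_one (by omega) hgg).trans (by norm_num)
    · obtain ⟨h, hh, hhg⟩ := hne g
      obtain ⟨l, l', Y, rfl, hgY, -, -⟩ :=
        exists_eq_cons_cons_cons hD hmax hU hc hL hg hh hhg.symm hgg
      simp only [Multiset.count_cons, Multiset.count_eq_zero.mpr hgY]
      split_ifs <;> omega
  · rw [Multiset.count_eq_zero.mpr hg]; omega

lemma exists_of_count_eq_two [DecidableEq G] {D : ℕ} {U : Multiset G} (hD : 6 ≤ D)
    (hmax : ∀ W : Multiset G, IsMinZeroSum W → Multiset.card W ≤ D) (hU : IsMinZeroSum U)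
    (hc : Multiset.card U = D)
    (hL : ∀ k ∈ partitionLengths (U + negSeq U), k = 2 ∨ k = 4 ∨ k = D) {g h : G}
    (hg : U.count g = 2) (hh : h ∈ U) (hgh : g ≠ h) :
    ∃ k Y, U = g ::ₘ g ::ₘ k ::ₘ Y ∧ k ≠ g ∧ g ∉ Y ∧ h ∈ Y ∧ g + g + g + k = 0 := by
  have hgg : g + g ≠ 0 := fun h => by
    have := hU.count_le_one (by omega) h
    omega
  obtain ⟨l, l', Y, rfl, hgY, hhY, hs⟩ := exists_eq_cons_cons_cons hD hmax hU hc hL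
    (Multiset.count_pos.mp (by omega)) hh hgh hgg
  simp only [Multiset.count_cons, Multiset.count_eq_zero.mpr hgY, if_true] at hg
  by_cases h1 : g = l
  · subst h1
    have h2 : l' ≠ g := fun h => by simp [h] at hg
    exact ⟨l', Y, rfl, h2, hgY, hhY, by rw [← hs]; abel⟩
  · by_cases h2 : g = l'
    · subst h2
      exact ⟨l, Y, by rw [Multiset.cons_swap l g], fun h => h1 h.symm, hgY, hhY,
        by rw [← hs]; abel⟩
    · simp [h1, h2] at hg

/-- Multiplicity two gives a term k = -3g; applying the shape lemma again with h = k shows that k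
occurs twice. Long powers of g can then be traded for copies of k, against the uniqueness of short
sums. -/
lemma count_ne_two [DecidableEq G] {D : ℕ} {U : Multiset G} (hD : 6 ≤ D)
    (hmax : ∀ W : Multiset G, IsMinZeroSum W → Multiset.card W ≤ D) (hU : IsMinZeroSum U)
    (hc : Multiset.card U = D)
    (hL : ∀ k ∈ partitionLengths (U + negSeq U), k = 2 ∨ k = 4 ∨ k = D)
    (hne : ∀ g, ∃ h ∈ U, h ≠ g) (g : G) : U.count g ≠ 2 := by
  intro hg
  obtain ⟨h, hh, hhg⟩ := hne g
  obtain ⟨k, Y, hUY, hkg, hgY, -, hk⟩ := exists_of_count_eq_two hD hmax hU hc hL hg hh hhg.symm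
  obtain ⟨k', Y', hUY', -, hgY', hkY', hk'⟩ :=
    exists_of_count_eq_two hD hmax hU hc hL hg (h := k) (by rw [hUY]; simp) hkg.symm
  obtain rfl : k = k' := add_left_cancel (hk.trans hk'.symm)
  obtain ⟨Z, rfl⟩ := Multiset.exists_cons_of_mem hkY'
  have hk3 := count_le_three hD hmax hU hc hL hne k
  have hcU := hc
  rw [hUY'] at hcU hk3
  simp only [Multiset.card_cons] at hcU
  simp only [Multiset.count_cons, if_true, if_neg hkg] at hk3
  have hgZ : g ∉ Z := fun h => hgY' (Multiset.mem_cons_of_mem h)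
  have hkZ : k ∉ Z.erase k := by
    rw [← Multiset.count_eq_zero, Multiset.count_erase_self]; omega
  have hcZ : D - 6 ≤ Multiset.card (Z.erase k) := by
    have := Multiset.card_le_card (Multiset.le_cons_erase Z k)
    rw [Multiset.card_cons] at this
    omega
  obtain ⟨R, hR, hRc⟩ := exists_le_card_eq hcZ
  have hRZ : R ≤ Z := hR.trans (Multiset.erase_le _ _)
  have hkR : k ∉ R := fun h => hkZ (Multiset.mem_of_le hR h)
  -- The sequence g⁶R has at least D terms and thus a zero-sum subsequence gⁱQ. For i < 3 it lies
  -- properly in U; otherwise -3g = k turns it into σ(g^(i-3)Q) = k or, for i = 6, σ(Q) = 2k. Each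
  -- is a short equality forcing k into Q.
  obtain ⟨T, hT, hT0, hTs⟩ := exists_zeroSum_of_le_card hmax
    (S := Multiset.replicate 6 g + R) (by simp; omega)
  obtain ⟨A, hA, Q, hQ, rfl⟩ := exists_eq_add_of_le_add hT
  obtain ⟨i, hi, rfl⟩ := Multiset.le_replicate_iff.mp hA
  have hQc := Multiset.card_le_card hQ
  have hkQ : k ∉ Q := fun h => hkR (Multiset.mem_of_le hQ h)
  have hle : ∀ j ≤ 2, Multiset.replicate j g + Q ≤ U := by
    intro j hj
    have h1 : Multiset.replicate j g ≤ Multiset.replicate 2 g :=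
      (Multiset.replicate_le_replicate g).mpr hj
    rw [hUY']
    calc Multiset.replicate j g + Q ≤ Multiset.replicate 2 g + Z :=
          add_le_add h1 (hQ.trans hRZ)
      _ = g ::ₘ g ::ₘ Z := by simp [Multiset.replicate_succ]
      _ ≤ g ::ₘ g ::ₘ k ::ₘ k ::ₘ Z := by
          refine Multiset.cons_le_cons _ (Multiset.cons_le_cons _ ?_)
          exact (Multiset.le_cons_self _ _).trans (Multiset.le_cons_self _ _)
  rw [Multiset.sum_add, Multiset.sum_replicate] at hTs
  have hk2 : ({k, k} : Multiset G) ≤ U := by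
    rw [hUY']
    refine le_trans ?_ ((Multiset.le_cons_self _ g).trans (Multiset.le_cons_self _ g))
    exact (Multiset.cons_le_cons_iff _).mpr ((Multiset.cons_le_cons_iff _).mpr (Multiset.zero_le _))
  rcases Nat.lt_or_ge i 3 with hi3 | hi3
  · exact hT0 (hU.eq_zero_of_card_lt (hle i (by omega)) (by simpa using hTs)
      (by simp; omega))
  rcases Nat.lt_or_ge i 6 with hi6 | hi6
  · have := eq_of_sum_eq_of_card_lt hD hU hc hL (hle (i - 3) (by omega))
      (B := {k}) (Multiset.singleton_le.mpr (by rw [hUY']; simp)) (by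
        obtain ⟨j, rfl⟩ := Nat.exists_eq_add_of_le hi3
        have h3 : (3 : ℕ) • g = -k := by
          rw [← eq_neg_iff_add_eq_zero] at hk
          rw [← hk]; abel
        rw [add_nsmul, h3] at hTs
        simp only [Multiset.sum_add, Multiset.sum_replicate, Multiset.sum_singleton,
          Nat.add_sub_cancel_left]
        rw [← sub_eq_zero, ← hTs]; abel) (by simp; omega)
    have hmem : k ∈ Multiset.replicate (i - 3) g + Q := by rw [this]; simp
    rcases Multiset.mem_add.mp hmem with h | h
    · exact hkg (Multiset.eq_of_mem_replicate h)
    · exact hkQ h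
  · obtain rfl : i = 6 := by omega
    have := eq_of_sum_eq_of_card_lt hD hU hc hL (A := Q)
      (by simpa using hle 0 (by omega)) hk2 (by
        have h3 : (6 : ℕ) • g = -(k + k) := by
          rw [← eq_neg_iff_add_eq_zero] at hk
          rw [neg_add, ← hk]; abel
        rw [h3] at hTs
        simp only [Multiset.insert_eq_cons, Multiset.sum_cons, Multiset.sum_singleton]
        rw [← sub_eq_zero, ← hTs]; abel) (by simp; omega)
    exact hkQ (by rw [this]; simp)

/-- All three copies of g lie outside Y, so l = l' = g in 2g + l + l' = 0. -/
lemma four_nsmul_of_count_eq_three [DecidableEq G] {D : ℕ} {U : Multiset G} (hD : 6 ≤ D)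
    (hmax : ∀ W : Multiset G, IsMinZeroSum W → Multiset.card W ≤ D) (hU : IsMinZeroSum U)
    (hc : Multiset.card U = D)
    (hL : ∀ k ∈ partitionLengths (U + negSeq U), k = 2 ∨ k = 4 ∨ k = D)
    (hne : ∀ g, ∃ h ∈ U, h ≠ g) {g : G} (hg : U.count g = 3) : g + g + (g + g) = 0 := by
  obtain ⟨h, hh, hhg⟩ := hne g
  have hgg : g + g ≠ 0 := fun h => by
    have := hU.count_le_one (by omega) h
    omega
  obtain ⟨l, l', Y, rfl, hgY, hhY, hs⟩ := exists_eq_cons_cons_cons hD hmax hU hc hL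
    (Multiset.count_pos.mp (by omega)) hh hhg.symm hgg
  simp only [Multiset.count_cons, Multiset.count_eq_zero.mpr hgY, if_true] at hg
  have h1 : g = l := by
    by_contra h; rw [if_neg h] at hg; split_ifs at hg; all_goals omega
  have h2 : g = l' := by
    by_contra h; rw [if_neg h] at hg; split_ifs at hg; all_goals omega
  rw [← h1, ← h2] at hs
  exact hs

/-- If U = g³h³R with 4g = 4h = 0, then σ(R) = g + h. This equality has weight at most D-4, so R
would contain a fourth copy of g. -/
lemma eq_of_count_eq_three [DecidableEq G] {D : ℕ} {U : Multiset G} (hD : 6 ≤ D)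
    (hmax : ∀ W : Multiset G, IsMinZeroSum W → Multiset.card W ≤ D) (hU : IsMinZeroSum U)
    (hc : Multiset.card U = D)
    (hL : ∀ k ∈ partitionLengths (U + negSeq U), k = 2 ∨ k = 4 ∨ k = D)
    (hne : ∀ g, ∃ h ∈ U, h ≠ g) {g h : G} (hg : U.count g = 3) (hh : U.count h = 3) : g = h := by
  by_contra hgh
  have h4g := four_nsmul_of_count_eq_three hD hmax hU hc hL hne hg
  have h4h := four_nsmul_of_count_eq_three hD hmax hU hc hL hne hh
  have hd : Disjoint (Multiset.replicate 3 g) (Multiset.replicate 3 h) := by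
    rw [Multiset.disjoint_left]
    intro x hx hy
    exact hgh ((Multiset.eq_of_mem_replicate hx).symm.trans (Multiset.eq_of_mem_replicate hy))
  obtain ⟨R, hR⟩ := Multiset.le_iff_exists_add.mp (add_le_of_disjoint
    (Multiset.le_count_iff_replicate_le.mp hg.ge) (Multiset.le_count_iff_replicate_le.mp hh.ge) hd)
  have hgR : g ∉ R := by
    rw [hR] at hg
    simp only [Multiset.count_add, Multiset.count_replicate_self] at hg
    exact Multiset.count_eq_zero.mp (by omega)
  have hUs := hU.2.1
  rw [hR] at hUs
  simp only [Multiset.sum_add, Multiset.sum_replicate] at hUs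
  have hUc := hc
  rw [hR] at hUc
  simp only [Multiset.card_add, Multiset.card_replicate] at hUc
  have := eq_of_sum_eq_of_card_lt hD hU hc hL (A := R) (B := {g, h})
    (by rw [hR]; exact Multiset.le_add_left _ _)
    (pair_le_of_ne (Multiset.count_pos.mp (by omega)) (Multiset.count_pos.mp (by omega)) hgh) (by
      simp only [Multiset.insert_eq_cons, Multiset.sum_cons, Multiset.sum_singleton]
      have h1 : (3 : ℕ) • g + 3 • h + R.sum = (g + g + (g + g)) + (h + h + (h + h)) +
        (R.sum - (g + h)) := by abel
      rw [h1, h4g, h4h, zero_add, zero_add] at hUs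
      exact sub_eq_zero.mp hUs) (by simp; omega)
  exact hgR (by rw [this]; simp)

/-- Applying the shape lemma with h = l yields a second pair m, m' with l + l' = m + m' in which l
does not occur. If m ≠ m', this relation has weight 4, which is admissible only when D - 2 = 4. -/
lemma exists_of_count_eq_one [DecidableEq G] {D : ℕ} {U : Multiset G} (hD : 6 ≤ D)
    (hmax : ∀ W : Multiset G, IsMinZeroSum W → Multiset.card W ≤ D) (hU : IsMinZeroSum U)
    (hc : Multiset.card U = D)
    (hL : ∀ k ∈ partitionLengths (U + negSeq U), k = 2 ∨ k = 4 ∨ k = D)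
    {g l l' : G} {Y : Multiset G} (hUY : U = g ::ₘ l ::ₘ l' ::ₘ Y) (hgg : g + g ≠ 0)
    (hg : U.count g = 1) (hl : U.count l = 1) (hs : g + g + (l + l') = 0) :
    (∃ m, 2 ≤ U.count m ∧ m ≠ g ∧ g + g + (m + m) = 0) ∨
      (D = 6 ∧ ∃ m m' f, U = {g, l, l', m, m', f} ∧ l + l' = m + m' ∧
        ({g, l, l', m, m'} : Multiset G).Nodup) := by
  have hgU : g ∈ U := by simp [hUY]
  have hlU : l ∈ U := by simp [hUY]
  have hgl : g ≠ l := by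
    rintro rfl
    simp [hUY] at hg
  have hgl' : g ≠ l' := by
    rintro rfl
    simp [hUY, Multiset.count_cons] at hg
  have hll' : l ≠ l' := by
    rintro rfl
    simp only [hUY, Multiset.count_cons, if_true] at hl
    omega
  obtain ⟨m, m', Z, hUZ, hgZ, hlZ, hsZ⟩ := exists_eq_cons_cons_cons hD hmax hU hc hL hgU hlU hgl hgg
  have hgm : g ≠ m := by
    rintro rfl
    simp [hUZ] at hg
  have hgm' : g ≠ m' := by
    rintro rfl
    simp [hUZ, Multiset.count_cons] at hg
  have hlZ1 := Multiset.one_le_count_iff_mem.mpr hlZ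
  have hlm : l ≠ m := by
    rintro rfl
    simp only [hUZ, Multiset.count_cons, if_true, if_neg hgl.symm] at hl
    omega
  have hlm' : l ≠ m' := by
    rintro rfl
    simp only [hUZ, Multiset.count_cons, if_true, if_neg hgl.symm] at hl
    omega
  by_cases hmm : m = m'
  · subst hmm
    left
    exact ⟨m, by simp only [hUZ, Multiset.count_cons, if_true]; omega, hgm.symm, hsZ⟩
  right
  have hsum : l + l' = m + m' := add_left_cancel (hs.trans hsZ.symm)
  have hl'm : l' ≠ m := by
    rintro rfl
    rw [add_comm] at hsum
    exact hlm' (add_left_cancel hsum)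
  have hl'm' : l' ≠ m' := by
    rintro rfl
    exact hlm (add_right_cancel hsum)
  have hl'U : l' ∈ U := by simp [hUY]
  have hmU : m ∈ U := by simp [hUZ]
  have hm'U : m' ∈ U := by simp [hUZ]
  have hD6 : D = 6 := by
    by_contra hD6
    have := eq_of_sum_eq_of_card_lt hD hU hc hL (pair_le_of_ne hlU hl'U hll')
      (pair_le_of_ne hmU hm'U hmm) (by simpa using hsum) (by simp; omega)
    have hmem : l ∈ ({m, m'} : Multiset G) := by rw [← this]; simp
    simp [hlm, hlm'] at hmem
  have hnd : ({g, l, l', m, m'} : Multiset G).Nodup := by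
    simp [hgl, hgl', hgm, hgm', hll', hlm, hlm', hl'm, hl'm', hmm]
  have hle : ({g, l, l', m, m'} : Multiset G) ≤ U := by
    rw [Multiset.le_iff_subset hnd]
    intro x hx
    simp only [Multiset.insert_eq_cons, Multiset.mem_cons, Multiset.mem_singleton] at hx
    rcases hx with rfl | rfl | rfl | rfl | rfl <;> assumption
  obtain ⟨R, hR⟩ := Multiset.le_iff_exists_add.mp hle
  have hRc := hc
  rw [hR, hD6] at hRc
  simp only [Multiset.insert_eq_cons, Multiset.card_add, Multiset.card_cons,
    Multiset.card_singleton] at hRc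
  obtain ⟨f, rfl⟩ := Multiset.card_eq_one.mp (by omega : Multiset.card R = 1)
  exact ⟨hD6, m, m', f, by rw [hR]; simp, hsum, hnd⟩

/-- Otherwise U is squarefree, which leaves only D = 6 and U = g l l' m m' f. Then g has order 6, f
= 3g, and the distinct terms l, l', m would all be 2g or 4g. -/
lemma exists_count_eq_three [DecidableEq G] {D : ℕ} {U : Multiset G} (hD : 6 ≤ D)
    (hmax : ∀ W : Multiset G, IsMinZeroSum W → Multiset.card W ≤ D) (hU : IsMinZeroSum U)
    (hc : Multiset.card U = D)
    (hL : ∀ k ∈ partitionLengths (U + negSeq U), k = 2 ∨ k = 4 ∨ k = D)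
    (hne : ∀ g, ∃ h ∈ U, h ≠ g) (hex : ∃ g ∈ U, g + g ≠ 0) : ∃ q, U.count q = 3 := by
  by_contra! h3
  have hle1 : ∀ x, U.count x ≤ 1 := fun x => by
    have h1 := count_le_three hD hmax hU hc hL hne x
    have h2 := count_ne_two hD hmax hU hc hL hne x
    have := h3 x
    omega
  have h1 : ∀ x ∈ U, U.count x = 1 := fun x hx =>
    le_antisymm (hle1 x) (Multiset.one_le_count_iff_mem.mpr hx)
  obtain ⟨g, hg, hgg⟩ := hex
  obtain ⟨h, hh, hhg⟩ := hne g
  obtain ⟨l, l', Y, hUY, -, -, hs⟩ := exists_eq_cons_cons_cons hD hmax hU hc hL hg hh hhg.symm hgg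
  rcases exists_of_count_eq_one hD hmax hU hc hL hUY hgg (h1 g hg) (h1 l (by simp [hUY])) hs with
    ⟨m, hm, -⟩ | ⟨hD6, m, m', f, hUeq, hsum, hnd⟩
  · have := hle1 m
    omega
  subst hD6
  have hUn : U.Nodup := Multiset.nodup_iff_count_le_one.mpr hle1
  have hpair : ∀ x ∈ U, ∀ y ∈ U, x ≠ y → x + y ≠ 0 := fun x hx y hy hxy =>
    hU.add_ne_zero (by omega) (pair_le_of_ne hx hy hxy)
  have hmem : ∀ x ∈ ({g, l, l', m, m', f} : Multiset G), x ∈ U := fun x hx => by rwa [hUeq]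
  simp only [Multiset.insert_eq_cons, Multiset.mem_cons, Multiset.mem_singleton, forall_eq_or_imp,
    forall_eq] at hmem
  obtain ⟨-, hlU, hl'U, hmU, hm'U, hfU⟩ := hmem
  rw [hUeq] at hUn
  simp only [Multiset.insert_eq_cons, Multiset.nodup_cons, Multiset.mem_cons,
    Multiset.mem_singleton, not_or, Multiset.nodup_singleton] at hUn
  obtain ⟨⟨ngl, ngl', ngm, ngm', ngf⟩, ⟨nll', nlm, nlm', nlf⟩, ⟨nl'm, nl'm', nl'f⟩, ⟨nmm', nmf⟩,
    nm'f, -⟩ := hUn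
  -- Subtract 2g + l + l' = 0 and 2g + m + m' = 0 from σ(U) = 0.
  have hf : f = g + g + g := by
    have hUs := hU.2.1
    rw [hUeq] at hUs
    simp only [Multiset.insert_eq_cons, Multiset.sum_cons, Multiset.sum_singleton] at hUs
    have e1 : g + (l + (l' + (m + (m' + f)))) =
        (g + g + (l + l')) + (g + g + (m + m')) + (f - (g + g + g)) := by abel
    rw [e1, ← hsum, hs, zero_add, zero_add] at hUs
    exact sub_eq_zero.mp hUs
  have hg0 : g ≠ 0 := fun h => hU.zero_notMem (by omega) (h ▸ hg)
  have hf0 : f ≠ 0 := fun h => hU.zero_notMem (by omega) (h ▸ hfU)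
  have h5 : g + g + f ≠ 0 := by
    intro h0
    have := eq_of_sum_eq_of_card_lt hD hU hc hL (Multiset.singleton_le.mpr hfU)
      (pair_le_of_ne hlU hl'U nll')
      (by
        simp only [Multiset.insert_eq_cons, Multiset.sum_cons, Multiset.sum_singleton]
        exact add_left_cancel (h0.trans hs.symm)) (by simp)
    have := congrArg Multiset.card this
    simp at this
  have hord : ∀ i, 0 < i → i < 6 → i • g ≠ 0 := by
    intro i hi0 hi6
    interval_cases i
    · simpa using hg0
    · simpa [two_nsmul] using hgg
    · rw [show 3 • g = f by rw [hf]; abel]; exact hf0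
    · rw [show 4 • g = g + f by rw [hf]; abel]; exact hpair g hg f hfU ngf
    · rw [show 5 • g = g + g + f by rw [hf]; abel]; exact h5
  have h6 : 6 • g = 0 := by
    obtain ⟨T, hT, hT0, hTs⟩ := exists_zeroSum_of_le_card hmax
      (S := Multiset.replicate 6 g) (by simp)
    obtain ⟨i, hi, rfl⟩ := Multiset.le_replicate_iff.mp hT
    rw [Multiset.sum_replicate] at hTs
    have hi0 : 0 < i := Nat.pos_of_ne_zero fun h => hT0 (by simp [h])
    by_cases hi6 : i = 6
    · rwa [hi6] at hTs
    · exact absurd hTs (hord i hi0 (by omega))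
  -- The sequence g⁵x has D = 6 terms, so x = (6 - i)g for some i ≤ 5; the values 0, -g, f and g are
  -- excluded.
  have hcyc : ∀ x ∈ U, g ≠ x → x ≠ f → x = 2 • g ∨ x = 4 • g := by
    intro x hx hgx hxf
    obtain ⟨T, hT, hT0, hTs⟩ := exists_zeroSum_of_le_card hmax
      (S := Multiset.replicate 5 g + {x}) (by simp)
    obtain ⟨A, hA, B, hB, rfl⟩ := exists_eq_add_of_le_add hT
    obtain ⟨i, hi, rfl⟩ := Multiset.le_replicate_iff.mp hA
    rw [Multiset.sum_add, Multiset.sum_replicate] at hTs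
    rcases Multiset.le_singleton.mp hB with rfl | rfl
    · exfalso
      have hi0 : 0 < i := Nat.pos_of_ne_zero fun h => hT0 (by simp [h])
      exact hord i hi0 (by omega) (by simpa using hTs)
    · rw [Multiset.sum_singleton] at hTs
      have hx6 : x = (6 - i) • g := by
        have : i • g + (6 - i) • g = 0 := by rw [← add_nsmul, Nat.add_sub_cancel' (by omega), h6]
        exact add_left_cancel (hTs.trans this.symm)
      interval_cases i
      · exact absurd (by simpa [h6] using hx6) (fun h : x = 0 => hU.zero_notMem (by omega) (h ▸ hx))
      · exact absurd (by simpa using hTs) (hpair g hg x hx hgx)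
      · right; exact hx6
      · exact absurd (hx6.trans (by rw [hf]; abel)) hxf
      · left; exact hx6
      · exact absurd (by simpa using hx6.symm) hgx
  have c1 := hcyc l hlU ngl nlf
  have c2 := hcyc l' hl'U ngl' nl'f
  have c3 := hcyc m hmU ngm nmf
  rcases c1 with c1 | c1 <;> rcases c2 with c2 | c2 <;> rcases c3 with c3 | c3 <;>
    first
    | exact nll' (c1.trans c2.symm)
    | exact nlm (c1.trans c3.symm)
    | exact nl'm (c2.trans c3.symm)

/-- An atom `U` of maximal length `D` with `L(U(-U)) = {2, 4, D}` forces `2G` to have order two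
and to be generated by the double of an element of order four. -/
theorem exists_two_nsmul_of_lengths {D : ℕ} {U : Multiset G} (hD : 6 ≤ D)
    (hmax : ∀ W : Multiset G, IsMinZeroSum W → Multiset.card W ≤ D) (hU : IsMinZeroSum U)
    (hc : Multiset.card U = D)
    (hL : ∀ k ∈ partitionLengths (U + negSeq U), k = 2 ∨ k = 4 ∨ k = D)
    (hmem : 4 ∈ partitionLengths (U + negSeq U)) :
    ∃ q : G, q + q ≠ 0 ∧ q + q + (q + q) = 0 ∧ ∀ x : G, x + x = 0 ∨ x + x = q + q := by
  classical
  have hne := exists_mem_ne hU (by omega) hmem (by omega) (by omega)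
  have hex := exists_add_self_ne_zero hU (by omega) hmem (by omega) (by omega)
  obtain ⟨q, hq⟩ := exists_count_eq_three hD hmax hU hc hL hne hex
  have hqU : q ∈ U := Multiset.count_pos.mp (by omega)
  have hq4 := four_nsmul_of_count_eq_three hD hmax hU hc hL hne hq
  have hone : ∀ x ∈ U, x ≠ q → U.count x = 1 := by
    intro x hx hxq
    have h1 := count_le_three hD hmax hU hc hL hne x
    have h2 := count_ne_two hD hmax hU hc hL hne x
    have h3 : U.count x ≠ 3 := fun h3 => hxq (eq_of_count_eq_three hD hmax hU hc hL hne h3 hq)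
    have := Multiset.count_pos.mpr hx
    omega
  have htwo : ∀ x, 2 ≤ U.count x → x = q := by
    intro x hx
    by_contra h
    have := hone x (Multiset.count_pos.mp (by omega)) h
    omega
  have hinv : ∀ x : G, x + x + (q + q) = 0 → x + x = q + q := fun x hx =>
    add_right_cancel (hx.trans hq4.symm)
  -- The repeated term m can only be q. In the exceptional shape five terms are distinct, so no
  -- multiplicity reaches three.
  have hcase : ∀ g ∈ U, g + g ≠ 0 → g ≠ q → ∀ l l' Y, U = g ::ₘ l ::ₘ l' ::ₘ Y →
      g + g + (l + l') = 0 → l ≠ q → g + g = q + q := by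
    intro g hg hgg hgq l l' Y hUY hs hlq
    rcases exists_of_count_eq_one hD hmax hU hc hL hUY hgg (hone g hg hgq)
      (hone l (by simp [hUY]) hlq) hs with ⟨m, hm, -, hs'⟩ | ⟨-, m, m', f, hUeq, -, hnd⟩
    · rw [htwo m hm] at hs'
      exact hinv g hs'
    · exfalso
      have h1 := Multiset.nodup_iff_count_le_one.mp hnd q
      have hUeq' : U = {g, l, l', m, m'} + {f} := by rw [hUeq]; simp
      rw [hUeq', Multiset.count_add, Multiset.count_singleton] at hq
      split_ifs at hq
      all_goals omega
  have hUtwo : ∀ g ∈ U, g + g = 0 ∨ g + g = q + q := by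
    intro g hg
    by_cases hgg : g + g = 0
    · exact Or.inl hgg
    right
    by_cases hgq : g = q
    · rw [hgq]
    obtain ⟨l, l', Y, hUY, -, -, hs⟩ := exists_eq_cons_cons_cons hD hmax hU hc hL hg hqU hgq hgg
    by_cases hlq : l = q
    · by_cases hlq' : l' = q
      · rw [hlq, hlq'] at hs
        exact hinv g hs
      · exact hcase g hg hgg hgq l' l Y (by rw [hUY, Multiset.cons_swap l])
          (by rw [add_comm l']; exact hs) hlq'
    · exact hcase g hg hgg hgq l l' Y hUY hs hlq
  refine ⟨q, fun h => ?_, hq4, fun x => ?_⟩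
  · have := hU.count_le_one (by omega) h
    omega
  -- Every x is a subsum of U, and the doubles {0, 2q} are closed under addition because 4q = 0.
  · obtain ⟨R, hR⟩ := Multiset.exists_cons_of_mem hqU
    obtain ⟨Y, hY, rfl⟩ := exists_sum_eq hmax hU hc hR x
    have hYU : ∀ y ∈ Y, y + y = 0 ∨ y + y = q + q := fun y hy => hUtwo y
      (by rw [hR]; exact Multiset.mem_cons_of_mem (Multiset.mem_of_le hY hy))
    clear hY
    induction Y using Multiset.induction_on with
    | empty => simp
    | cons a s ih =>
      have h1 := hYU a (Multiset.mem_cons_self a s)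
      have h2 := ih fun y hy => hYU y (Multiset.mem_cons_of_mem hy)
      rw [Multiset.sum_cons, add_add_add_comm]
      rcases h1 with h1 | h1 <;> rcases h2 with h2 | h2 <;> rw [h1, h2] <;> simp [hq4]

/-- A group with an atom of maximal length is finite. -/
lemma finite_of_isMinZeroSum {D : ℕ} {U : Multiset G}
    (hmax : ∀ W : Multiset G, IsMinZeroSum W → Multiset.card W ≤ D) (hU : IsMinZeroSum U)
    (hc : Multiset.card U = D) : Finite G := by
  obtain ⟨h, hh⟩ := Multiset.exists_mem_of_ne_zero hU.1
  obtain ⟨R, hR⟩ := Multiset.exists_cons_of_mem hh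
  have hfin : Set.Finite {Y : Multiset G | Y ≤ R} := by
    classical
    exact (R.powerset.toFinset.finite_toSet).subset fun Y hY => by
      simpa using hY
  have := hfin.image Multiset.sum
  refine Set.finite_univ_iff.mp (this.subset fun x _ => ?_)
  obtain ⟨Y, hY, hYs⟩ := exists_sum_eq hmax hU hc hR x
  exact ⟨Y, hY, hYs⟩

end LargeRank
end SetsOfLengths
namespace SetsOfLengths

/-! ### Groups whose doubles lie in {0, 2q} -/

section Structure

variable {G : Type*} [AddCommGroup G]

/-- A finite group whose doubles are `0` and the double of an element of order four is
`C₂ᵇ ⊕ C₄`. -/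
lemma exists_addEquiv_pi_zmod_two_prod_zmod_four [Finite G] {q : G} (hq : q + q ≠ 0)
    (hq4 : q + q + (q + q) = 0) (hG : ∀ x : G, x + x = 0 ∨ x + x = q + q) :
    ∃ b : ℕ, Nonempty (G ≃+ (Fin b → ZMod 2) × ZMod 4) := by
  let H := G ⧸ AddSubgroup.zmultiples q
  have hH : ∀ x : H, 2 • x = 0 := by
    intro x
    induction x using QuotientAddGroup.induction_on with
    | H x =>
      rw [two_nsmul, ← QuotientAddGroup.mk_add, QuotientAddGroup.eq_zero_iff]
      rcases hG x with h | h <;> rw [h]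
      · exact zero_mem _
      · exact add_mem (AddSubgroup.mem_zmultiples q) (AddSubgroup.mem_zmultiples q)
  let _ : Module (ZMod 2) H := AddCommGroup.zmodModule hH
  have : Module.Finite (ZMod 2) H := Module.Finite.of_finite
  let B := Module.finBasis (ZMod 2) H
  -- The quotient by ⟨q⟩ is an F₂-space. A class with representative x has one of order at most two:
  -- x, or x - q when 2x = 2q. So the extension splits.
  have hlift : ∀ i, ∃ s : G, s + s = 0 ∧ (QuotientAddGroup.mk s : H) = B i := by
    intro i
    obtain ⟨x, hx⟩ := QuotientAddGroup.mk_surjective (B i)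
    rcases hG x with h | h
    · exact ⟨x, h, hx⟩
    · refine ⟨x - q, ?_, ?_⟩
      · rw [sub_add_sub_comm, h, sub_self]
      · rw [QuotientAddGroup.mk_sub, hx,
          (QuotientAddGroup.eq_zero_iff q).mpr (AddSubgroup.mem_zmultiples q), sub_zero]
  choose s hs hsB using hlift
  let φ : (i : Fin (Module.finrank (ZMod 2) H)) → ZMod 2 →+ G := fun i =>
    ZMod.lift 2 ⟨zmultiplesHom G (s i), by simp [two_zsmul, hs]⟩
  have hφ : ∀ i (j : ℕ), φ i (j : ZMod 2) = j • s i := by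
    intro i j
    have : φ i ((j : ℤ) : ZMod 2) = j • s i := by
      simp only [φ]
      rw [ZMod.lift_coe]; simp
    rwa [Int.cast_natCast] at this
  have hφB : ∀ i (c : ZMod 2), (QuotientAddGroup.mk (φ i c) : H) = c • B i := by
    intro i c
    rw [← ZMod.natCast_zmod_val c, hφ, Nat.cast_smul_eq_nsmul, ← hsB i]
    rfl
  let ψ : ZMod 4 →+ G := ZMod.lift 4 ⟨zmultiplesHom G q, by
    simp only [Nat.cast_ofNat, zmultiplesHom_apply]
    rw [show (4 : ℤ) = 2 + 2 by norm_num, add_zsmul, two_zsmul, hq4]⟩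
  have hψ : ∀ j : ℕ, ψ (j : ZMod 4) = j • q := by
    intro j
    have : ψ ((j : ℤ) : ZMod 4) = j • q := by
      simp only [ψ]
      rw [ZMod.lift_coe]; simp
    rwa [Int.cast_natCast] at this
  have hψH : ∀ c, (QuotientAddGroup.mk (ψ c) : H) = 0 := by
    intro c
    rw [← ZMod.natCast_zmod_val c, hψ, QuotientAddGroup.eq_zero_iff]
    exact nsmul_mem (AddSubgroup.mem_zmultiples q) _
  let f : (Fin (Module.finrank (ZMod 2) H) → ZMod 2) × ZMod 4 →+ G :=
    AddMonoidHom.coprod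
      (∑ i, (φ i).comp (Pi.evalAddMonoidHom (fun _ => ZMod 2) i)) ψ
  have hf : ∀ v c, f (v, c) = ∑ i, φ i (v i) + ψ c := by
    intro v c
    simp [f, AddMonoidHom.finsetSum_apply]
  have hfH : ∀ v c, (QuotientAddGroup.mk (f (v, c)) : H) = ∑ i, v i • B i := by
    intro v c
    rw [hf, QuotientAddGroup.mk_add, hψH, add_zero]
    have := map_sum (QuotientAddGroup.mk' (AddSubgroup.zmultiples q)) (fun i => φ i (v i))
      Finset.univ
    simp only [QuotientAddGroup.mk'_apply] at this
    rw [this]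
    exact Finset.sum_congr rfl fun i _ => hφB i _
  refine ⟨Module.finrank (ZMod 2) H, ⟨(AddEquiv.ofBijective f ⟨?_, ?_⟩).symm⟩⟩
  · rw [injective_iff_map_eq_zero]
    rintro ⟨v, c⟩ h
    have h1 := hfH v c
    rw [h, QuotientAddGroup.mk_zero] at h1
    have hv : v = 0 := funext (Fintype.linearIndependent_iff.mp B.linearIndependent v h1.symm)
    subst hv
    rw [hf] at h
    simp only [Pi.zero_apply, map_zero, Finset.sum_const_zero, zero_add] at h
    have hc := ZMod.natCast_zmod_val c
    have hcl := ZMod.val_lt c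
    have hq0 : q ≠ 0 := fun h => hq (by simp [h])
    rw [← hc, hψ] at h
    rw [← hc]
    generalize c.val = j at *
    interval_cases j
    · simp
    · simp at h; exact absurd h hq0
    · rw [two_nsmul] at h; exact absurd h hq
    · exfalso
      apply hq0
      have h4 : q + q + (q + q) = 3 • q + q := by abel
      rw [hq4, h, zero_add] at h4
      exact h4.symm
  · intro x
    have hx : (QuotientAddGroup.mk (x - f (B.repr (QuotientAddGroup.mk x), 0)) : H) = 0 := by
      rw [QuotientAddGroup.mk_sub, hfH, B.sum_repr, sub_self]
    rw [QuotientAddGroup.eq_zero_iff, AddSubgroup.mem_zmultiples_iff] at hx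
    obtain ⟨k, hk⟩ := hx
    refine ⟨(B.repr (QuotientAddGroup.mk x), (k : ZMod 4)), ?_⟩
    have : ψ (k : ZMod 4) = k • q := by
      simp only [ψ]
      rw [ZMod.lift_coe]; simp
    rw [hf] at hk ⊢
    rw [map_zero, add_zero] at hk
    rw [this, hk]; abel

end Structure

/-! ### Davenport constant of C₂ᵇ ⊕ C₄ via the group algebra -/

section Davenport

/-- If the product of the elements `1 + X g` of the group algebra over the terms of a sequence
vanishes, then the sequence has a non-empty zero-sum subsequence. -/
lemma exists_zeroSum_of_prod_eq_zero {R G : Type*} [CommRing R] [Nontrivial R] [AddCommGroup G]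
    (S : Multiset G)
    (h : (S.map fun g => (1 + AddMonoidAlgebra.single g 1 : AddMonoidAlgebra R G)).prod = 0) :
    ∃ T ≤ S, T ≠ 0 ∧ T.sum = 0 := by
  classical
  -- The empty subsequence contributes exactly the coefficients of 1, so any deviation at x comes
  -- from a non-empty subsequence with sum x.
  have key : ∀ S : Multiset G, ∀ x,
      (S.map fun g => (1 + AddMonoidAlgebra.single g 1 : AddMonoidAlgebra R G)).prod.coeff x
        ≠ (if 0 = x then 1 else 0) → ∃ T ≤ S, T ≠ 0 ∧ T.sum = x := by
    intro S
    induction S using Multiset.induction_on with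
    | empty =>
      intro x hx
      refine absurd ?_ hx
      rw [Multiset.map_zero, Multiset.prod_zero, AddMonoidAlgebra.one_def,
        AddMonoidAlgebra.coeff_single, Finsupp.single_apply]
    | cons a S ih =>
      intro x hx
      rw [Multiset.map_cons, Multiset.prod_cons, add_mul, one_mul, AddMonoidAlgebra.coeff_add,
        Finsupp.add_apply, AddMonoidAlgebra.coeff_single_mul_apply, one_mul] at hx
      by_cases h1 : (S.map fun g =>
          (1 + AddMonoidAlgebra.single g 1 : AddMonoidAlgebra R G)).prod.coeff x
          = (if 0 = x then 1 else 0)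
      · rw [h1] at hx
        by_cases hxa : x = a
        · exact ⟨{a}, by simp, by simp, by simp [hxa]⟩
        · obtain ⟨T, hT, -, hTs⟩ := ih (-a + x) (by
            rw [if_neg (fun h => hxa (by rw [← sub_eq_zero, h]; abel))]
            simpa using hx)
          exact ⟨a ::ₘ T, (Multiset.cons_le_cons_iff a).mpr hT, by simp, by simp [hTs]⟩
      · obtain ⟨T, hT, hT0, hTs⟩ := ih x h1
        exact ⟨T, hT.trans (Multiset.le_cons_self _ _), hT0, hTs⟩
  refine key S 0 ?_
  rw [h]
  simp

/-- Stated for semirings so that it applies to a sum of ideals. -/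
lemma sum_pow_eq_zero_of_sq_eq_zero {R ι : Type*} [CommSemiring R] (s : Finset ι) (x : ι → R)
    (hx : ∀ i ∈ s, x i ^ 2 = 0) : (∑ i ∈ s, x i) ^ (s.card + 1) = 0 := by
  classical
  induction s using Finset.induction_on with
  | empty => simp
  | insert a s ha ih =>
    rw [Finset.sum_insert ha, Finset.card_insert_of_notMem ha]
    exact (Commute.all _ _).add_pow_eq_zero_of_add_le_succ_of_pow_eq_zero
      (hx a (Finset.mem_insert_self a s)) (ih fun i hi => hx i (Finset.mem_insert_of_mem hi))
      (by omega)

/-- The Davenport constant of `C₂ᵇ ⊕ C₄` is at most `b + 4`. -/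
lemma exists_zeroSum_pi_zmod_two_prod_zmod_four {b : ℕ}
    (S : Multiset ((Fin b → ZMod 2) × ZMod 4)) (hS : b + 4 ≤ Multiset.card S) :
    ∃ T ≤ S, T ≠ 0 ∧ T.sum = 0 := by
  refine exists_zeroSum_of_prod_eq_zero (R := ZMod 2) S ?_
  let A := AddMonoidAlgebra (ZMod 2) ((Fin b → ZMod 2) × ZMod 4)
  let X : (Fin b → ZMod 2) × ZMod 4 → A := fun g => AddMonoidAlgebra.single g 1
  have h2 : (2 : A) = 0 := by
    have := map_ofNat (algebraMap (ZMod 2) A) 2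
    rw [← this, show (OfNat.ofNat 2 : ZMod 2) = 0 from rfl, map_zero]
  have hX : ∀ g h, X (g + h) = X g * X h := fun g h => by
    change AddMonoidAlgebra.single (g + h) (1 : ZMod 2) =
      AddMonoidAlgebra.single g 1 * AddMonoidAlgebra.single h 1
    rw [AddMonoidAlgebra.single_mul_single, one_mul]
  have hX0 : X 0 = 1 := rfl
  have hsq : ∀ g, (1 + X g) ^ 2 = 1 + X (g + g) := fun g => by
    rw [hX]; linear_combination X g * h2
  let e : Fin b → (Fin b → ZMod 2) × ZMod 4 := fun i => (Pi.single i 1, 0)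
  -- In characteristic two the first b generators square to zero and the last has fourth power zero,
  -- so J is nilpotent of exponent (b + 1) + 4 - 1.
  let J : Ideal A := ∑ i, Ideal.span {1 + X (e i)} + Ideal.span {1 + X (0, 1)}
  have hJ : J ^ (b + 4) = 0 := by
    have h1 : (∑ i, Ideal.span {1 + X (e i)}) ^ (b + 1) = 0 := by
      have := sum_pow_eq_zero_of_sq_eq_zero Finset.univ (fun i => Ideal.span {1 + X (e i)})
        (fun i _ => by
          rw [Ideal.span_singleton_pow, hsq, show e i + e i = 0 by
            ext j
            · simp only [e, Prod.mk_add_mk, Prod.fst_zero, Pi.zero_apply, Pi.add_apply]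
              exact CharTwo.add_self_eq_zero _
            · simp [e], hX0, show (1 + 1 : A) = 2 by norm_num, h2]
          simp)
      simpa using this
    have h3 : (Ideal.span {1 + X (0, 1)}) ^ 4 = 0 := by
      rw [Ideal.span_singleton_pow, show (1 + X (0, 1)) ^ 4 = ((1 + X (0, 1)) ^ 2) ^ 2 by ring,
        hsq, hsq, show ((0, 1) + (0, 1) + ((0, 1) + (0, 1)) : (Fin b → ZMod 2) × ZMod 4) = 0 by
          simp only [Prod.mk_add_mk, add_zero]
          exact Prod.ext rfl (show (1 + 1 + (1 + 1) : ZMod 4) = 0 by decide), hX0, show (1 + 1 : A) = 2 by norm_num, h2]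
      simp
    exact (Commute.all _ _).add_pow_eq_zero_of_add_le_succ_of_pow_eq_zero h1 h3 (by omega)
  have hadd : ∀ g h, 1 + X g ∈ J → 1 + X h ∈ J → 1 + X (g + h) ∈ J := by
    intro g h hg hh
    have : 1 + X (g + h) = X h * (1 + X g) + (1 + X h) := by
      rw [hX]; linear_combination -X h * h2
    rw [this]
    exact add_mem (Ideal.mul_mem_left _ _ hg) hh
  have hzero : 1 + X 0 ∈ J := by
    rw [hX0, show (1 + 1 : A) = 2 by norm_num, h2]; exact zero_mem _
  -- The g with 1 + X g in J are closed under addition and include generators of the group, so every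
  -- factor of the product lies in J.
  let M : AddSubmonoid ((Fin b → ZMod 2) × ZMod 4) :=
    { carrier := {g | 1 + X g ∈ J}
      add_mem' := fun {g h} hg hh => hadd g h hg hh
      zero_mem' := hzero }
  have he : ∀ i, e i ∈ M := fun i => by
    refine Ideal.mem_sup_left (?_ : _ ∈ ∑ i, Ideal.span {1 + X (e i)})
    exact (Finset.single_le_sum (f := fun i => Ideal.span {1 + X (e i)})
      (fun i _ => bot_le) (Finset.mem_univ i)) (Ideal.mem_span_singleton_self _)
  have hq : ((0, 1) : (Fin b → ZMod 2) × ZMod 4) ∈ M :=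
    Ideal.mem_sup_right (Ideal.mem_span_singleton_self _)
  have hall : ∀ g, g ∈ M := by
    rintro ⟨v, c⟩
    have : (v, c) = ∑ i, (v i).val • e i + c.val • ((0, 1) : (Fin b → ZMod 2) × ZMod 4) := by
      refine Prod.ext ?_ ?_
      · rw [Prod.fst_add, Prod.fst_sum]
        ext j
        simp only [e, Prod.smul_mk, Finset.sum_apply, Pi.smul_apply, Pi.single_apply, smul_ite,
          smul_zero, add_zero, Finset.sum_ite_eq, Finset.mem_univ, if_true, nsmul_one,
          ZMod.natCast_zmod_val]
      · rw [Prod.snd_add, Prod.snd_sum]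
        simp [e]
    rw [this]
    exact add_mem (sum_mem fun i _ => nsmul_mem (he i) _) (nsmul_mem hq _)
  have hprod : ∀ S : Multiset ((Fin b → ZMod 2) × ZMod 4),
      (S.map fun g => 1 + X g).prod ∈ J ^ Multiset.card S := by
    intro S
    induction S using Multiset.induction_on with
    | empty => simp
    | cons a S ih =>
      rw [Multiset.map_cons, Multiset.prod_cons, Multiset.card_cons, pow_succ']
      exact Ideal.mul_mem_mul (hall a) ih
  have := Ideal.pow_le_pow_right hS (hprod S)
  rw [hJ] at this
  simpa using this

end Davenport
end SetsOfLengths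
namespace SetsOfLengths

/-! ### Davenport constant of C₂ ⊕ C₂ₙ via Erdős–Ginzburg–Ziv -/

section Davenport

lemma exists_le_map_eq {α β : Type*} {f : α → β} {S : Multiset α} {A : Multiset β}
    (h : A ≤ S.map f) : ∃ T ≤ S, T.map f = A := by
  classical
  induction S using Multiset.induction_on generalizing A with
  | empty => exact ⟨0, le_rfl, by simpa [eq_comm] using h.antisymm (Multiset.zero_le _)⟩
  | cons a S ih =>
    rw [Multiset.map_cons] at h
    by_cases ha : f a ∈ A
    · obtain ⟨B, rfl⟩ := Multiset.exists_cons_of_mem ha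
      obtain ⟨T, hT, rfl⟩ := ih ((Multiset.cons_le_cons_iff _).mp h)
      exact ⟨a ::ₘ T, (Multiset.cons_le_cons_iff _).mpr hT, by simp⟩
    · obtain ⟨T, hT, rfl⟩ := ih ((Multiset.le_cons_of_notMem ha).mp h)
      exact ⟨T, hT.trans (Multiset.le_cons_self _ _), rfl⟩

/-- Among `n` integers there is a non-empty subfamily whose sum is divisible by `n`. -/
lemma exists_dvd_sum_of_le_card {n : ℕ} (hn : 0 < n) (S : Multiset ℤ) (hS : n ≤ Multiset.card S) :
    ∃ T ≤ S, T ≠ 0 ∧ (n : ℤ) ∣ T.sum := by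
  -- Padding with n - 1 zeros reaches the 2n - 1 terms required; the n chosen terms cannot all be
  -- padding.
  obtain ⟨T, hT, hTc, hTs⟩ := Int.erdos_ginzburg_ziv_multiset (n := n)
    (S + Multiset.replicate (n - 1) 0) (by simp; omega)
  obtain ⟨A, hA, B, hB, rfl⟩ := exists_eq_add_of_le_add hT
  obtain ⟨i, hi, rfl⟩ := Multiset.le_replicate_iff.mp hB
  refine ⟨A, hA, ?_, by simpa using hTs⟩
  rintro rfl
  simp at hTc
  omega

lemma exists_pair_of_card {α β : Type*} [Fintype β] (f : α → β) {S : Multiset α}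
    (hS : Fintype.card β < Multiset.card S) : ∃ x y, {x, y} ≤ S ∧ f x = f y := by
  classical
  have : ¬ (S.map f).Nodup := by
    intro h
    have := Finset.card_le_univ (⟨S.map f, h⟩ : Finset β)
    simp at this
    omega
  rw [Multiset.nodup_iff_count_le_one] at this
  push Not at this
  obtain ⟨a, ha⟩ := this
  obtain ⟨T, hT, hTa⟩ := exists_le_map_eq (Multiset.le_count_iff_replicate_le.mp ha)
  have hc : Multiset.card T = 2 := by rw [← Multiset.card_map f T, hTa]; simp
  obtain ⟨x, y, rfl⟩ := Multiset.card_eq_two.mp hc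
  have h : ∀ u ∈ ({x, y} : Multiset α), f u = a := fun u hu =>
    Multiset.eq_of_mem_replicate (by rw [← hTa]; exact Multiset.mem_map_of_mem f hu)
  exact ⟨x, y, hT, by rw [h x (by simp), h y (by simp)]⟩

lemma exists_zeroSum_of_three_le_card {G : Type*} [AddCommGroup G]
    (f : G →+ ZMod 2 × ZMod 2) {S : Multiset G} (hS : 3 ≤ Multiset.card S) :
    ∃ T ≤ S, T ≠ 0 ∧ f T.sum = 0 := by
  obtain ⟨R, hR, hRc⟩ := exists_le_card_eq hS
  obtain ⟨a, b, c, rfl⟩ := Multiset.card_eq_three.mp hRc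
  have key : ∀ u v w : ZMod 2 × ZMod 2, u = 0 ∨ v = 0 ∨ u + v = 0 ∨ w = 0 ∨ v + w = 0 ∨
      u + w = 0 ∨ u + v + w = 0 := by decide
  have h1 : ({a} : Multiset G) ≤ {a, b, c} := by simp
  have h2 : ({b, c} : Multiset G) ≤ {a, b, c} := Multiset.le_cons_self _ _
  have h3 : ({b} : Multiset G) ≤ {a, b, c} := by simp
  have h4 : ({c} : Multiset G) ≤ {a, b, c} := by simp
  have h5 : ({a, b} : Multiset G) ≤ {a, b, c} :=
    (Multiset.cons_le_cons_iff a).mpr (by simp)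
  have h6 : ({a, c} : Multiset G) ≤ {a, b, c} :=
    (Multiset.cons_le_cons_iff a).mpr (by simp)
  rcases key (f a) (f b) (f c) with h | h | h | h | h | h | h
  · exact ⟨_, h1.trans hR, by simp, by simpa using h⟩
  · exact ⟨_, h3.trans hR, by simp, by simpa using h⟩
  · exact ⟨_, h5.trans hR, by simp, by simpa using h⟩
  · exact ⟨_, h4.trans hR, by simp, by simpa using h⟩
  · exact ⟨_, h2.trans hR, by simp, by simpa using h⟩
  · exact ⟨_, h6.trans hR, by simp, by simpa using h⟩
  · exact ⟨_, hR, by simp, by simpa [add_assoc] using h⟩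

/-- While at least five terms remain, two share an image in C₂², and this pair is a block. The last
three terms contain a block since C₂² has Davenport constant 3. -/
lemma exists_partition_of_le_card {G : Type*} [AddCommGroup G] (f : G →+ ZMod 2 × ZMod 2)
    (k : ℕ) {S : Multiset G} (hS : 2 * k + 1 ≤ Multiset.card S) :
    ∃ z : Multiset (Multiset G), Multiset.card z = k ∧ z.sum ≤ S ∧
      ∀ W ∈ z, W ≠ 0 ∧ f W.sum = 0 := by
  induction k generalizing S with
  | zero => exact ⟨0, by simp⟩
  | succ k ih =>
    rcases Nat.eq_zero_or_pos k with rfl | hk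
    · obtain ⟨T, hT, hT0, hTs⟩ := exists_zeroSum_of_three_le_card f (S := S) (by omega)
      exact ⟨{T}, by simp, by simpa using hT, by simpa using ⟨hT0, hTs⟩⟩
    · obtain ⟨x, y, hxy, hf⟩ := exists_pair_of_card f (S := S)
        (by simp only [Fintype.card_prod, ZMod.card]; omega)
      obtain ⟨R, rfl⟩ := Multiset.le_iff_exists_add.mp hxy
      rw [Multiset.card_add] at hS
      simp only [Multiset.insert_eq_cons, Multiset.card_cons, Multiset.card_singleton] at hS
      obtain ⟨z, hz, hzs, hzf⟩ := ih (S := R) (by omega)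
      have h2 : ∀ u : ZMod 2 × ZMod 2, u + u = 0 := by decide
      refine ⟨{x, y} ::ₘ z, by simp [hz], ?_, ?_⟩
      · rw [Multiset.sum_cons]
        exact add_le_add le_rfl hzs
      · intro W hW
        rcases Multiset.mem_cons.mp hW with rfl | hW
        · exact ⟨by simp, by simp [hf, h2]⟩
        · exact hzf W hW

/-- The Davenport constant of `C₂ ⊕ C₂ₙ` is at most `2n + 1`. -/
lemma exists_zeroSum_zmod_two_prod {n : ℕ} (hn : 0 < n) (S : Multiset (ZMod 2 × ZMod (2 * n)))
    (hS : 2 * n + 1 ≤ Multiset.card S) : ∃ T ≤ S, T ≠ 0 ∧ T.sum = 0 := by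
  have : NeZero (2 * n) := ⟨by omega⟩
  let f : ZMod 2 × ZMod (2 * n) →+ ZMod 2 × ZMod 2 :=
    AddMonoidHom.prodMap (AddMonoidHom.id _)
      (ZMod.castHom (dvd_mul_right 2 n) (ZMod 2)).toAddMonoidHom
  have hf : ∀ x, f x = 0 → ∃ c : ℕ, x = (0, ((2 * c : ℕ) : ZMod (2 * n))) := by
    rintro ⟨a, x⟩ h
    have h1 : a = 0 := congrArg Prod.fst h
    have h2 : ZMod.castHom (dvd_mul_right 2 n) (ZMod 2) x = 0 := congrArg Prod.snd h
    rw [← ZMod.natCast_zmod_val x, map_natCast, ZMod.natCast_eq_zero_iff] at h2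
    obtain ⟨c, hc⟩ := h2
    exact ⟨c, by rw [h1, ← hc, ZMod.natCast_zmod_val]⟩
  -- The n disjoint blocks have sums (0, 2c); among the n numbers c some non-empty subfamily has sum
  -- divisible by n.
  obtain ⟨z, hz, hzs, hzf⟩ := exists_partition_of_le_card f n hS
  have hex : ∀ W : Multiset (ZMod 2 × ZMod (2 * n)), ∃ c : ℕ, f W.sum = 0 →
      W.sum = (0, ((2 * c : ℕ) : ZMod (2 * n))) := by
    intro W
    by_cases h : f W.sum = 0
    · obtain ⟨c, hc⟩ := hf _ h
      exact ⟨c, fun _ => hc⟩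
    · exact ⟨0, fun h' => absurd h' h⟩
  choose c hc using hex
  obtain ⟨A, hA, hA0, hAs⟩ := exists_dvd_sum_of_le_card hn (z.map fun W => (c W : ℤ))
    (by simp [hz])
  obtain ⟨y, hy, rfl⟩ := exists_le_map_eq hA
  have hyf : ∀ W ∈ y, W ≠ 0 ∧ f W.sum = 0 := fun W hW => hzf W (Multiset.mem_of_le hy hW)
  refine ⟨y.sum, le_trans ?_ hzs, ?_, ?_⟩
  · obtain ⟨w, rfl⟩ := Multiset.le_iff_exists_add.mp hy
    rw [Multiset.sum_add]; exact Multiset.le_add_right _ _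
  · intro h
    have hy0 : y ≠ 0 := by rintro rfl; simp at hA0
    obtain ⟨W, hW⟩ := Multiset.exists_mem_of_ne_zero hy0
    have h1 := le_sum_of_mem_partition hW
    rw [h] at h1
    exact (hyf W hW).1 (h1.antisymm (Multiset.zero_le _))
  · have hsum : ∀ y : Multiset (Multiset (ZMod 2 × ZMod (2 * n))), (∀ W ∈ y, f W.sum = 0) →
        y.sum.sum = (0, ((2 * (y.map fun W => (c W : ℤ)).sum : ℤ) : ZMod (2 * n))) := by
      intro y hy
      induction y using Multiset.induction_on with
      | empty => exact Prod.ext rfl (by simp)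
      | cons W y ih =>
        rw [Multiset.sum_cons, Multiset.sum_add, ih fun V hV => hy V (Multiset.mem_cons_of_mem hV),
          hc W (hy W (Multiset.mem_cons_self W y)), Multiset.map_cons, Multiset.sum_cons]
        refine Prod.ext (by simp) ?_
        generalize (y.map fun W => (c W : ℤ)).sum = s
        rw [Prod.snd_add]
        push_cast
        ring
    rw [hsum y fun W hW => (hyf W hW).2]
    refine Prod.ext rfl ?_
    obtain ⟨t, ht⟩ := hAs
    rw [Prod.snd_zero, ht, ZMod.intCast_zmod_eq_zero_iff_dvd]
    exact ⟨t, by push_cast; ring⟩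

end Davenport
end SetsOfLengths
namespace SetsOfLengths

/-! ### Lengths of U(-U) when long atoms share a term of order two -/

section CommonAtom

variable {G : Type*} [AddCommGroup G]

lemma two_mem_partitionLengths {U : Multiset G} (hU : IsMinZeroSum U) :
    2 ∈ partitionLengths (U + negSeq U) :=
  ⟨{U, negSeq U}, by
    intro W hW
    simp only [Multiset.insert_eq_cons, Multiset.mem_cons, Multiset.mem_singleton] at hW
    rcases hW with rfl | rfl
    exacts [hU, hU.neg], by simp, by simp⟩

lemma card_mem_partitionLengths {U : Multiset G} (h0 : 0 ∉ U) :
    Multiset.card U ∈ partitionLengths (U + negSeq U) := by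
  refine ⟨U.map fun g => {g, -g}, ?_, ?_, by simp⟩
  · intro W hW
    obtain ⟨g, hg, rfl⟩ := Multiset.mem_map.mp hW
    exact isMinZeroSum_pair (fun h => h0 (h ▸ hg))
  · clear h0
    induction U using Multiset.induction_on with
    | empty => simp
    | cons a s ih =>
      rw [Multiset.map_cons, Multiset.sum_cons, ih, negSeq_cons]
      simp only [Multiset.insert_eq_cons, ← Multiset.singleton_add]
      abel

/-- `j` counts the blocks of length two, `i` those among them equal to {e, e}, and `m` the remaining
blocks. -/
lemma exists_counts_of_partition [DecidableEq G] {e : G} (he : e = -e) {t : ℕ}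
    {z : Multiset (Multiset G)}
    (hz : ∀ W ∈ z, W.sum = 0 ∧ (Multiset.card W = 2 ∨ Multiset.card W = t ∧ W.count e = 1)) :
    ∃ i j m, Multiset.card z = j + m ∧ Multiset.card z.sum = 2 * j + t * m ∧
      z.sum.count e = 2 * i + m := by
  induction z using Multiset.induction_on with
  | empty => exact ⟨0, 0, 0, by simp⟩
  | cons W z ih =>
    obtain ⟨i, j, m, h1, h2, h3⟩ := ih fun V hV => hz V (Multiset.mem_cons_of_mem hV)
    simp only [Multiset.card_cons, Multiset.sum_cons, Multiset.card_add, Multiset.count_add,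
      h1, h2, h3]
    obtain ⟨hW0, hW | ⟨hW, hWe⟩⟩ := hz W (Multiset.mem_cons_self W z)
    · obtain ⟨x, rfl⟩ := eq_pair_of_card_eq_two hW0 hW
      by_cases hx : e = x
      · subst hx
        refine ⟨i + 1, j + 1, m, by omega, by rw [hW]; ring, ?_⟩
        rw [← he]
        simp
        ring
      · refine ⟨i, j + 1, m, by omega, by rw [hW]; ring, ?_⟩
        have hx' : e ≠ -x := fun h => hx (by rw [he, h, neg_neg])
        simp [hx, hx']
    · exact ⟨i, j, m + 1, by omega, by rw [hW]; ring, by rw [hWe]; ring⟩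

/-- The set of lengths of `U + (-U)` when all its atoms of length greater than two, apart from `U`
and `-U`, have length `t` and contain a fixed term `e` of order two exactly once. -/
lemma eq_of_mem_partitionLengths_add_neg [DecidableEq G] {U : Multiset G} (hU : IsMinZeroSum U)
    {e : G} (he : e + e = 0) (heU : U.count e = 1) {t : ℕ}
    (hW : ∀ W ≤ U + negSeq U, IsMinZeroSum W → Multiset.card W = 2 ∨ W = U ∨ W = negSeq U ∨
      Multiset.card W = t ∧ W.count e = 1) {k : ℕ} (hk : k ∈ partitionLengths (U + negSeq U)) :
    k = 2 ∨ k = Multiset.card U ∨ k + t = Multiset.card U + 2 := by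
  obtain ⟨z, hz, hzs, rfl⟩ := hk
  by_cases h1 : U ∈ z
  · exact Or.inl (card_partition_eq_two hU.neg hz hzs h1)
  by_cases h2 : negSeq U ∈ z
  · exact Or.inl (card_partition_eq_two hU hz (by rw [hzs, add_comm]) h2)
  right
  have hne : e = -e := eq_neg_of_add_eq_zero_left he
  obtain ⟨i, j, m, h3, h4, h5⟩ := exists_counts_of_partition hne (t := t) (z := z) (by
    intro W hWz
    refine ⟨(hz W hWz).2.1, ?_⟩
    rcases hW W (hzs ▸ le_sum_of_mem_partition hWz) (hz W hWz) with h | rfl | rfl | h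
    · exact Or.inl h
    · exact absurd hWz h1
    · exact absurd hWz h2
    · exact Or.inr h)
  rw [hzs, Multiset.count_add, count_negSeq, ← hne, heU] at h5
  rw [hzs, Multiset.card_add, card_negSeq] at h4
  -- The term e = -e occurs exactly twice in U(-U), so 2i + m = 2.
  have hm : m = 0 ∨ m = 2 := by omega
  rcases hm with rfl | rfl
  · left; omega
  · right; omega

end CommonAtom

/-! ### An atom over C₂ᵇ ⊕ C_m with set of lengths {2, m, b + m} -/

section Model

variable {b m : ℕ}

/-- The element of `C₂ᵇ ⊕ C_m` whose only non-zero coordinate is the `i`-th one. -/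
def modelBasis (b m : ℕ) (i : Fin b) : (Fin b → ZMod 2) × ZMod m := (Pi.single i 1, 0)

/-- The subsequence of `modelAtom` given by a set of basis elements and two multiplicities. -/
def modelSeq (m : ℕ) (F : Finset (Fin b)) (a d : ℕ) : Multiset ((Fin b → ZMod 2) × ZMod m) :=
  F.val.map (modelBasis b m) + Multiset.replicate a (0, 1) +
    Multiset.replicate d ((fun _ => 1), 1)

/-- An atom of length `b + m` over `C₂ᵇ ⊕ C_m`. -/
def modelAtom (b m : ℕ) : Multiset ((Fin b → ZMod 2) × ZMod m) :=
  modelSeq m Finset.univ (m - 1) 1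

lemma modelBasis_injective : Function.Injective (modelBasis b m) := by
  intro i j h
  by_contra hij
  have := congrFun (congrArg Prod.fst h) i
  simp [modelBasis, hij] at this

lemma card_modelSeq (F : Finset (Fin b)) (a d : ℕ) :
    Multiset.card (modelSeq m F a d) = F.card + a + d := by
  simp [modelSeq]

lemma sum_modelSeq (F : Finset (Fin b)) (a d : ℕ) :
    (modelSeq m F a d).sum =
      ((fun j => (if j ∈ F then 1 else 0) + (d : ZMod 2)), (a + d : ZMod m)) := by
  have : (F.val.map (modelBasis b m)).sum = ((fun j => if j ∈ F then 1 else 0), 0) := by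
    change ∑ i ∈ F, modelBasis b m i = _
    refine Prod.ext ?_ ?_
    · rw [Prod.fst_sum]
      ext j
      simp only [modelBasis, Finset.sum_apply, Pi.single_apply, Finset.sum_ite_eq]
    · rw [Prod.snd_sum]
      simp [modelBasis]
  rw [modelSeq, Multiset.sum_add, Multiset.sum_add, this]
  refine Prod.ext ?_ ?_
  · ext j
    simp
  · simp

lemma exists_eq_modelSeq_of_le {F : Finset (Fin b)} {a d : ℕ}
    {T : Multiset ((Fin b → ZMod 2) × ZMod m)} (h : T ≤ modelSeq m F a d) :
    ∃ F' ⊆ F, ∃ a' ≤ a, ∃ d' ≤ d, T = modelSeq m F' a' d' := by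
  obtain ⟨A, hA, D, hD, rfl⟩ := exists_eq_add_of_le_add h
  obtain ⟨E, hE, Q, hQ, rfl⟩ := exists_eq_add_of_le_add hA
  obtain ⟨a', ha', rfl⟩ := Multiset.le_replicate_iff.mp hQ
  obtain ⟨d', hd', rfl⟩ := Multiset.le_replicate_iff.mp hD
  obtain ⟨F', hF', rfl⟩ := exists_le_map_eq hE
  exact ⟨⟨F', Multiset.nodup_of_le hF' F.nodup⟩, Finset.val_le_iff.mp hF', a', ha', d', hd', rfl⟩

lemma isMinZeroSum_modelAtom (hm : 2 ≤ m) : IsMinZeroSum (modelAtom b m) := by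
  have hsum : (modelAtom b m).sum = 0 := by
    rw [modelAtom, sum_modelSeq]
    refine Prod.ext ?_ ?_
    · ext j
      simp only [Finset.mem_univ, if_true, Nat.cast_one, Prod.fst_zero, Pi.zero_apply]
      decide
    · simp [← Nat.cast_add_one, Nat.sub_add_cancel (by omega : 1 ≤ m)]
  refine ⟨fun h => ?_, hsum, fun T hT hT0 => ?_⟩
  · have := congrArg Multiset.card h
    rw [modelAtom, card_modelSeq] at this
    simp at this
  · obtain ⟨F, -, a, ha, d, hd, rfl⟩ := exists_eq_modelSeq_of_le hT
    rw [sum_modelSeq, ← Nat.cast_add] at hT0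
    have h1 : ∀ j, (if j ∈ F then 1 else 0) + (d : ZMod 2) = 0 := fun j =>
      congrFun (congrArg Prod.fst hT0) j
    have h2 := (ZMod.natCast_eq_zero_iff _ _).mp (congrArg Prod.snd hT0)
    interval_cases d
    · left
      have hF : F = ∅ := by
        ext j
        have := h1 j
        by_cases hj : j ∈ F <;> simp [hj] at this ⊢
      have ha0 : a = 0 := Nat.eq_zero_of_dvd_of_lt h2 (by omega)
      simp [hF, ha0, modelSeq]
    · right
      have hF : F = Finset.univ := by
        ext j
        have := h1 j
        by_cases hj : j ∈ F <;> simp [hj] at this ⊢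
      have ha0 : a = m - 1 := by
        have := Nat.le_of_dvd (by omega) h2
        omega
      rw [hF, ha0, modelAtom]

lemma count_modelSeq (hm : 2 ≤ m) (F : Finset (Fin b)) (a d : ℕ) (i : Fin b) :
    (modelSeq m F a d).count (modelBasis b m i) = if i ∈ F then 1 else 0 := by
  have : Fact (1 < m) := ⟨by omega⟩
  have h1 : ∀ v : Fin b → ZMod 2, (v, (1 : ZMod m)) ≠ modelBasis b m i := fun v h =>
    one_ne_zero (congrArg Prod.snd h)
  rw [modelSeq, Multiset.count_add, Multiset.count_add, Multiset.count_replicate,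
    Multiset.count_replicate, if_neg (h1 _), if_neg (h1 _),
    Multiset.count_map_eq_count' _ _ modelBasis_injective, Multiset.count_eq_of_nodup F.nodup]
  simp

lemma modelBasis_add_self (i : Fin b) : modelBasis b m i + modelBasis b m i = 0 := by
  refine Prod.ext ?_ (by simp [modelBasis])
  ext j
  simp only [modelBasis, Prod.fst_add, Pi.add_apply, Prod.fst_zero, Pi.zero_apply]
  exact CharTwo.add_self_eq_zero _

lemma modelBasis_eq_neg (i : Fin b) : modelBasis b m i = -modelBasis b m i :=
  eq_neg_of_add_eq_zero_left (modelBasis_add_self i)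

lemma modelSeq_add_negSeq_compl (F : Finset (Fin b)) (a d : ℕ) :
    modelSeq m F a d + negSeq (modelSeq m Fᶜ 0 0) = modelSeq m Finset.univ a d := by
  have h1 : negSeq (modelSeq m Fᶜ 0 0) = Fᶜ.val.map (modelBasis b m) := by
    rw [modelSeq, Multiset.replicate_zero, Multiset.replicate_zero, add_zero, add_zero, negSeq,
      Multiset.map_map]
    exact Multiset.map_congr rfl fun i _ => (modelBasis_eq_neg i).symm
  have h2 : F.val + Fᶜ.val = (Finset.univ : Finset (Fin b)).val := by
    have : F.disjUnion Fᶜ disjoint_compl_right = Finset.univ := by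
      ext j; simp
    rw [← this]; rfl
  rw [h1, modelSeq, modelSeq, ← h2, Multiset.map_add]
  abel

/-- The atoms that divide `modelAtom + (-modelAtom)` and contain the distinguished term. -/
lemma eq_modelAtom_or_card_eq (hm : 3 ≤ m) (i : Fin b) {F F' : Finset (Fin b)} {a a' : ℕ}
    (ha : a ≤ m - 1) (ha' : a' ≤ m - 1) (haa : a = 0 ∨ a' = 0)
    (hs : (modelSeq m F a 1).sum = (modelSeq m F' a' 0).sum) :
    modelSeq m F a 1 + negSeq (modelSeq m F' a' 0) = modelAtom b m ∨
      Multiset.card (modelSeq m F a 1 + negSeq (modelSeq m F' a' 0)) = b + 2 ∧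
        (modelSeq m F a 1 + negSeq (modelSeq m F' a' 0)).count (modelBasis b m i) = 1 := by
  rw [sum_modelSeq, sum_modelSeq] at hs
  have h1 : ∀ j, (if j ∈ F then 1 else 0) + ((1 : ℕ) : ZMod 2) =
      (if j ∈ F' then 1 else 0) + ((0 : ℕ) : ZMod 2) := fun j => congrFun (congrArg Prod.fst hs) j
  have h2 : (a : ZMod m) + ((1 : ℕ) : ZMod m) = a' + ((0 : ℕ) : ZMod m) := congrArg Prod.snd hs
  -- The first coordinates put each basis element on exactly one side; the second say a + 1 ≡ a' mod
  -- m, so (a, a') is (0, 1) or (m-1, 0).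
  have hF : F' = Fᶜ := by
    ext j
    have := h1 j
    rw [Finset.mem_compl]
    by_cases hj : j ∈ F <;> by_cases hj' : j ∈ F' <;> simp [hj, hj'] at this ⊢
  subst hF
  rw [← Nat.cast_add, ← Nat.cast_add, ZMod.natCast_eq_natCast_iff] at h2
  rcases haa with rfl | rfl
  · right
    have ha1 : a' = 1 := by
      have : 1 % m = a' % m := by rw [zero_add, add_zero] at h2; exact h2
      rw [Nat.mod_eq_of_lt (by omega), Nat.mod_eq_of_lt (by omega)] at this
      exact this.symm
    subst ha1
    constructor
    · have := Finset.card_add_card_compl F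
      rw [Fintype.card_fin] at this
      rw [Multiset.card_add, card_negSeq, card_modelSeq, card_modelSeq]
      omega
    · rw [Multiset.count_add, count_negSeq, ← modelBasis_eq_neg, count_modelSeq (by omega),
        count_modelSeq (by omega)]
      by_cases hi : i ∈ F <;> simp [hi]
  · left
    have ha1 : a = m - 1 := by
      have h3 : m ∣ a + 1 := (Nat.modEq_zero_iff_dvd).mp (by simpa using h2)
      have := Nat.le_of_dvd (by omega) h3
      omega
    rw [ha1, modelSeq_add_negSeq_compl, modelAtom]

lemma isMinZeroSum_le_modelAtom_add_neg (hm : 3 ≤ m) (i : Fin b)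
    {W : Multiset ((Fin b → ZMod 2) × ZMod m)} (hWle : W ≤ modelAtom b m + negSeq (modelAtom b m))
    (hW : IsMinZeroSum W) :
    Multiset.card W = 2 ∨ W = modelAtom b m ∨ W = negSeq (modelAtom b m) ∨
      Multiset.card W = b + 2 ∧ W.count (modelBasis b m i) = 1 := by
  obtain ⟨A, hA, B, hB, rfl⟩ := exists_eq_add_negSeq_of_le hWle
  by_cases hd : Disjoint A B
  swap
  · left
    obtain ⟨x, hxA, hxB⟩ : ∃ x ∈ A, x ∈ B := by
      rw [Multiset.disjoint_left] at hd
      push Not at hd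
      exact hd
    have hle : ({x, -x} : Multiset _) ≤ A + negSeq B := by
      have : ({x, -x} : Multiset ((Fin b → ZMod 2) × ZMod m)) = {x} + {-x} := rfl
      rw [this]
      exact add_le_add (by simpa using hxA) (by simpa using hxB)
    rw [← hW.eq_of_le hle (by simp) (by simp)]
    simp
  have hs : A.sum = B.sum := by simpa [add_neg_eq_zero] using hW.2.1
  obtain ⟨F, -, a, ha, d, hd1, rfl⟩ := exists_eq_modelSeq_of_le hA
  obtain ⟨F', -, a', ha', d', hd1', rfl⟩ := exists_eq_modelSeq_of_le hB
  rw [Multiset.disjoint_left] at hd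
  have haa : a = 0 ∨ a' = 0 := by
    by_contra! h
    refine hd (a := (0, 1)) ?_ ?_ <;> simp [modelSeq, Multiset.mem_replicate, h.1, h.2]
  have hFF : ∀ j ∈ F, j ∉ F' := by
    intro j hj hj'
    refine hd (a := modelBasis b m j) ?_ ?_
    · simp only [modelSeq, Multiset.mem_add]
      exact Or.inl (Or.inl (Multiset.mem_map_of_mem _ hj))
    · simp only [modelSeq, Multiset.mem_add]
      exact Or.inl (Or.inl (Multiset.mem_map_of_mem _ hj'))
  interval_cases d <;> interval_cases d'
  · exfalso
    apply hW.1
    rw [sum_modelSeq, sum_modelSeq] at hs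
    have h1 : ∀ j, (if j ∈ F then 1 else 0) + ((0 : ℕ) : ZMod 2) =
        (if j ∈ F' then 1 else 0) + ((0 : ℕ) : ZMod 2) := fun j =>
      congrFun (congrArg Prod.fst hs) j
    have h2 : (a : ZMod m) + ((0 : ℕ) : ZMod m) = a' + ((0 : ℕ) : ZMod m) :=
      congrArg Prod.snd hs
    have hF : ∀ j, j ∉ F ∧ j ∉ F' := by
      intro j
      have := h1 j
      have h3 := hFF j
      by_cases hj : j ∈ F <;> by_cases hj' : j ∈ F' <;> simp [hj, hj'] at this h3 ⊢
    have hF0 : F = ∅ := Finset.eq_empty_of_forall_notMem fun j => (hF j).1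
    have hF0' : F' = ∅ := Finset.eq_empty_of_forall_notMem fun j => (hF j).2
    rw [← Nat.cast_add, ← Nat.cast_add, ZMod.natCast_eq_natCast_iff'] at h2
    rw [Nat.mod_eq_of_lt (by omega), Nat.mod_eq_of_lt (by omega)] at h2
    have ha0 : a = 0 := by omega
    have ha0' : a' = 0 := by omega
    simp [hF0, hF0', ha0, ha0', modelSeq]
  · have hneg : modelSeq m F a 0 + negSeq (modelSeq m F' a' 1) =
        negSeq (modelSeq m F' a' 1 + negSeq (modelSeq m F a 0)) := by
      simp [add_comm]
    rw [hneg]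
    rcases eq_modelAtom_or_card_eq hm i ha' ha haa.symm hs.symm with h | h
    · right; right; left; rw [h]
    · right; right; right
      rwa [card_negSeq, count_negSeq, ← modelBasis_eq_neg]
  · rcases eq_modelAtom_or_card_eq hm i ha ha' haa hs with h | h
    · exact Or.inr (Or.inl h)
    · exact Or.inr (Or.inr (Or.inr h))
  · exfalso
    refine hd (a := ((fun _ => 1), 1)) ?_ ?_ <;> simp [modelSeq]

lemma card_modelAtom (hm : 1 ≤ m) : Multiset.card (modelAtom b m) = b + m := by
  rw [modelAtom, card_modelSeq, Finset.card_univ, Fintype.card_fin]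
  omega

/-- `{2, m, b + m}` is a set of lengths over `C₂ᵇ ⊕ C_m`. -/
theorem partitionLengths_modelAtom (hb : 1 ≤ b) (hm : 3 ≤ m) :
    partitionLengths (modelAtom b m + negSeq (modelAtom b m)) = {2, m, b + m} := by
  have hU := isMinZeroSum_modelAtom (b := b) (m := m) (by omega)
  have hc := card_modelAtom (b := b) (m := m) (by omega)
  let i : Fin b := ⟨0, hb⟩
  have hsub : ∀ k ∈ partitionLengths (modelAtom b m + negSeq (modelAtom b m)),
      k = 2 ∨ k = m ∨ k = b + m := by
    intro k hk
    have := eq_of_mem_partitionLengths_add_neg hU (modelBasis_add_self i)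
      (by rw [modelAtom, count_modelSeq (by omega)]; simp)
      (fun W hWle hW => isMinZeroSum_le_modelAtom_add_neg hm i hWle hW) hk
    rw [hc] at this
    omega
  refine Set.Subset.antisymm (fun k hk => by simpa using hsub k hk) ?_
  rintro k (rfl | rfl | rfl)
  · exact two_mem_partitionLengths hU
  · have : Fact (1 < k) := ⟨by omega⟩
    -- The basis elements and (1,…,1; 1) add up to (0, 1), a relation of weight b + 2. It yields the
    -- length k - 2 + 2p with p ≥ 1 and 3p ≤ b + 2, which among the three candidates can only be k.
    have hA : modelSeq k Finset.univ 0 1 ≤ modelAtom b k := by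
      rw [modelAtom, modelSeq, modelSeq]
      exact add_le_add (add_le_add le_rfl (by simp)) le_rfl
    have hB : ({(0, 1)} : Multiset ((Fin b → ZMod 2) × ZMod k)) ≤ modelAtom b k := by
      rw [Multiset.singleton_le, modelAtom, modelSeq]
      simp only [Multiset.mem_add, Multiset.mem_replicate]
      exact Or.inl (Or.inr ⟨by omega, trivial⟩)
    obtain ⟨p, l, hp, h3, hl, hlL⟩ := exists_length_of_relation hU (by omega) hA hB (by
        rw [Multiset.disjoint_singleton, modelSeq]
        simp only [Multiset.mem_add, Multiset.mem_replicate, Multiset.mem_map]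
        rintro ((⟨j, -, hj⟩ | h) | h)
        · exact zero_ne_one (congrArg Prod.snd hj)
        · exact h.1 rfl
        · exact zero_ne_one (congrFun (congrArg Prod.fst h.2) i)) (by
        rw [sum_modelSeq]
        refine Prod.ext ?_ (by simp)
        ext j
        simp only [Finset.mem_univ, if_true, Nat.cast_one, Multiset.sum_singleton, Pi.zero_apply]
        decide) (by simp)
    have hl' := hsub l hlL
    rw [card_modelSeq, hc, Multiset.card_singleton, Finset.card_univ, Fintype.card_fin] at hl
    rw [card_modelSeq, Multiset.card_singleton, Finset.card_univ, Fintype.card_fin] at h3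
    have : l = k := by omega
    rwa [this] at hlL
  · have := card_mem_partitionLengths (hU.zero_notMem (by omega))
    rwa [hc] at this

end Model
end SetsOfLengths
namespace SetsOfLengths

/-! ### Transfer of extremal lengths and conclusion -/

section Transfer

variable {G H : Type*} [AddCommGroup G] [AddCommGroup H]

lemma card_le_of_exists_zeroSum {D : ℕ}
    (h : ∀ S : Multiset G, D ≤ Multiset.card S → ∃ T ≤ S, T ≠ 0 ∧ T.sum = 0)
    (U : Multiset G) (hU : IsMinZeroSum U) : Multiset.card U ≤ D := by
  by_contra! hlt
  obtain ⟨a, ha⟩ := Multiset.exists_mem_of_ne_zero hU.1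
  obtain ⟨R, rfl⟩ := Multiset.exists_cons_of_mem ha
  rw [Multiset.card_cons] at hlt
  obtain ⟨T, hT, hT0, hTs⟩ := h R (by omega)
  have hc := Multiset.card_le_card hT
  exact hT0 (hU.eq_zero_of_card_lt (hT.trans (Multiset.le_cons_self _ _)) hTs
    (by rw [Multiset.card_cons]; omega))

/-- The set L(W(-W)) contains 2 and |W| and also occurs over H, where the presence of 2 caps every
length by D. -/
lemma card_le_of_groupLengthSystem_eq (hGH : groupLengthSystem G = groupLengthSystem H) {D : ℕ}
    (hD : 2 ≤ D) (hmax : ∀ W : Multiset H, IsMinZeroSum W → Multiset.card W ≤ D)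
    (W : Multiset G) (hW : IsMinZeroSum W) : Multiset.card W ≤ D := by
  by_contra! hlt
  have hmem : partitionLengths (W + negSeq W) ∈ groupLengthSystem H := by
    rw [← hGH, mem_groupLengthSystem_iff]
    exact ⟨_, by simp, rfl⟩
  obtain ⟨S, -, hS⟩ := (mem_groupLengthSystem_iff _).mp hmem
  have := le_of_two_mem_partitionLengths hD hmax (hS ▸ two_mem_partitionLengths hW)
    (hS ▸ card_mem_partitionLengths (hW.zero_notMem (by omega)))
  omega

lemma exists_isMinZeroSum_of_groupLengthSystem_eq {b m : ℕ} (hb : 1 ≤ b) (hm : 3 ≤ m)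
    (hG : groupLengthSystem G = groupLengthSystem ((Fin b → ZMod 2) × ZMod m))
    (hmax : ∀ W : Multiset G, IsMinZeroSum W → Multiset.card W ≤ b + m) :
    ∃ U : Multiset G, IsMinZeroSum U ∧ Multiset.card U = b + m ∧
      partitionLengths (U + negSeq U) = {2, m, b + m} := by
  have hmem : ({2, m, b + m} : Set ℕ) ∈ groupLengthSystem G := by
    rw [hG, mem_groupLengthSystem_iff]
    exact ⟨_, by simp, partitionLengths_modelAtom hb hm⟩
  obtain ⟨S, -, hS⟩ := (mem_groupLengthSystem_iff _).mp hmem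
  obtain ⟨U, hU, hc, rfl⟩ := exists_eq_add_negSeq (by omega) hmax (S := S)
    (by rw [hS]; simp) (by rw [hS]; simp)
  exact ⟨U, hU, hc, hS⟩

/-- The identification of `C₂¹ ⊕ C_m` with `C₂ ⊕ C_m`. -/
def finOneProdEquiv (m : ℕ) : (Fin 1 → ZMod 2) × ZMod m ≃+ ZMod 2 × ZMod m :=
  AddEquiv.prodCongr (AddEquiv.piUnique fun _ : Fin 1 => ZMod 2) (AddEquiv.refl _)

theorem nonempty_addEquiv_of_groupLengthSystem_eq_rank_two {n : ℕ} (hn : 2 ≤ n)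
    (hG : groupLengthSystem G = groupLengthSystem (ZMod 2 × ZMod (2 * n))) :
    Nonempty (G ≃+ ZMod 2 × ZMod (2 * n)) := by
  have hmax := card_le_of_groupLengthSystem_eq hG (D := 2 * n + 1) (by omega)
    (card_le_of_exists_zeroSum fun S hS => exists_zeroSum_zmod_two_prod (by omega) S hS)
  rw [← groupLengthSystem_congr (finOneProdEquiv (2 * n))] at hG
  obtain ⟨U, hU, hc, hL⟩ := exists_isMinZeroSum_of_groupLengthSystem_eq le_rfl (by omega) hG
    (by rwa [add_comm])
  rw [add_comm 1] at hc hL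
  have := nonempty_addEquiv_zmod_two_prod_of_lengths (by omega) hmax hU hc
    (fun k hk => by rw [hL] at hk; simpa using hk) (by rw [hL]; simp)
  rwa [Nat.add_sub_cancel] at this

theorem nonempty_addEquiv_of_groupLengthSystem_eq_exponent_four {b : ℕ} (hb : 2 ≤ b)
    (hG : groupLengthSystem G = groupLengthSystem ((Fin b → ZMod 2) × ZMod 4)) :
    Nonempty (G ≃+ (Fin b → ZMod 2) × ZMod 4) := by
  have hmodel : ∀ c : ℕ, ∀ W : Multiset ((Fin c → ZMod 2) × ZMod 4), IsMinZeroSum W →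
      Multiset.card W ≤ c + 4 := fun c =>
    card_le_of_exists_zeroSum fun S hS => exists_zeroSum_pi_zmod_two_prod_zmod_four S hS
  have hmax := card_le_of_groupLengthSystem_eq hG (by omega) (hmodel b)
  obtain ⟨U, hU, hc, hL⟩ := exists_isMinZeroSum_of_groupLengthSystem_eq (by omega) (by norm_num)
    hG hmax
  obtain ⟨q, hq, hq4, hG2⟩ := exists_two_nsmul_of_lengths (by omega) hmax hU hc
    (fun k hk => by rw [hL] at hk; simpa using hk) (by rw [hL]; simp)
  have := finite_of_isMinZeroSum hmax hU hc
  obtain ⟨c, ⟨f⟩⟩ := exists_addEquiv_pi_zmod_two_prod_zmod_four hq hq4 hG2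
  -- Maximal atom lengths on both sides give b + 4 ≤ c + 4 and c + 4 ≤ b + 4.
  have h1 := hmodel c _ (hU.map_equiv f)
  have h2 := hmax _ ((isMinZeroSum_modelAtom (b := c) (m := 4) (by norm_num)).map_equiv f.symm)
  rw [Multiset.card_map, hc] at h1
  rw [Multiset.card_map, card_modelAtom (by norm_num)] at h2
  obtain rfl : c = b := by omega
  exact ⟨f⟩

end Transfer
end SetsOfLengths

theorem corollary1p3 {G : Type*} [AddCommGroup G] :
    (∀ r : ℕ, 2 ≤ r →
      SetsOfLengths.groupLengthSystem G =
        SetsOfLengths.groupLengthSystem ((Fin (r - 1) → ZMod 2) × ZMod 4) →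
      Nonempty (G ≃+ (Fin (r - 1) → ZMod 2) × ZMod 4)) ∧
    (∀ n : ℕ, 2 ≤ n →
      SetsOfLengths.groupLengthSystem G =
        SetsOfLengths.groupLengthSystem (ZMod 2 × ZMod (2 * n)) →
      Nonempty (G ≃+ ZMod 2 × ZMod (2 * n))) := by
  refine ⟨fun r hr hG => ?_, fun n hn hG =>
    SetsOfLengths.nonempty_addEquiv_of_groupLengthSystem_eq_rank_two hn hG⟩
  -- For r = 2 one has D = 5, too small for the analysis of {2, 4, D}; but {2, 4, 5} is {2, D-1, D},
  -- so the other case applies with n = 2.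
  rcases hr.eq_or_lt with rfl | hr
  · obtain ⟨f⟩ := SetsOfLengths.nonempty_addEquiv_of_groupLengthSystem_eq_rank_two (n := 2) le_rfl
      (hG.trans (SetsOfLengths.groupLengthSystem_congr (SetsOfLengths.finOneProdEquiv 4)))
    exact ⟨f.trans (SetsOfLengths.finOneProdEquiv 4).symm⟩
  · exact SetsOfLengths.nonempty_addEquiv_of_groupLengthSystem_eq_exponent_four (by omega) hG
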